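/- Let $K$ be an algebraically closed field and let $n,k\ge 1$, $d>1$ be integers with $kd\le n+1$ (complete intersections of $k$ hypersurfaces of degree $d$ in $\mathbb P^n$ are Fano if $kd\le n$ and Calabi–Yau if $kd=n+1$). Let $\mathcal R=\mathrm{Gr}(k,H^0(\mathbb P^n,\mathcal O(d)))\times \mathbb P(H^0(\mathbb P^n,\mathcal O(1)))$ be the parameter space of pairs $(S,H)$, where $S=\{f_1=\dots=f_k=0\}$ is given by the linear system $\Phi=\langle f_1,\dots,f_k\rangle$ of dimension $k$ (as a vector space) of forms of degree $d$, and $H=\{h=0\}$ is a hyperplane; put $D=S\cap H$. The group $G=\mathrm{SL}_{n+1}(K)$ acts on $\mathcal R$ by substitution. For rational $t=b/a>0$ (with integers $a,b>0$) let $\overline M^{GIT}_{n,d,k}(t)=\mathrm{Proj}\bigoplus_j H^0(\mathcal R,\mathcal O(a,b)^{\otimes j})^{G}$; its points are the images of the points of the semistable locus $\mathcal R^{ss}_t$, where some invariant section of positive degree does not vanish, and two semistable points have the same image iff the same homogeneous invariants vanish at them. For rational $t\ge 0$ a pair $(S,H)$ is called $t$-semistable if $\mu_t(S,H,\lambda)=\mu(f_1\wedge\dots\wedge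 f_k,\lambda)+t\,\mu(h,\lambda)\ge 0$ for all nontrivial one-parameter subgroups $\lambda$ of $G$, where $\mu(\cdot,\lambda)$ is the largest $\lambda$-weight of a monomial, in coordinates diagonalising $\lambda$, that occurs with nonzero coefficient. 1. Let $t>0$. Every point of $\overline M^{GIT}_{n,d,k}(t)$ is the image of a pair $(S,H)$ whose $G$-orbit is closed in $\mathcal R^{ss}_t$. For every pair $(S,H)$ in $\mathcal R^{ss}_t$ lying over that point (in particular for the one with closed orbit), $H$ is not contained in any hypersurface $\{f=0\}$, $0\ne f\in\Phi$; equivalently, $f_1|_H,\dots,f_k|_H$ are linearly independent. If moreover $S$ is a complete intersection (of codimension $k$), and $S$ is an integral variety or $k=1$ or $k=d=2$, then $D$ is a divisor on $S$ (that is, $H$ contains no irreducible component of $S$) and $D$ is itself a complete intersection, of codimension $k+1$ in $\mathbb P^n$. 2. Let $kd\le n$ (Fano case), let $0\le t\le \frac{kd}{n}$ be rational and let $(S,H)$ be $t$-semistable. Then $H$ is not contained in any hypersurface $\{f=0\}$, $0\ne f\in\Phi$. If $t<1$, no hypersurface $\{f=0\}$, $0\neq f\in\Phi$, contains any hyperplane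 of $\mathbb P^n$. If $k\ge2$, then for every hyperplane $L$ at least one of the hypersurfaces $\{f_i=0\}$ does not contain $L$. If $S$ is a complete intersection, and $S$ is an integral variety or $k=1$ or $k=d=2$, then $D$ is a divisor on $S$ and is itself a complete intersection, of codimension $k+1$ in $\mathbb P^n$. -/

import Mathlib

namespace VGIT

open MvPolynomial

/-- Polynomials in the homogeneous coordinates `x_0, …, x_n` of projective `n`-space over `K`. -/
abbrev Form (K : Type*) [Field K] (n : ℕ) : Type _ := MvPolynomial (Fin (n + 1)) K

/-- Exponent vectors of the monomials of degree `d` in `x_0, …, x_n`. -/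
abbrev Mon (n d : ℕ) : Type :=
  ↥(Finset.finsuppAntidiag (Finset.univ : Finset (Fin (n + 1))) d)

/-- The substitution `f(x) ↦ f(A x)`. -/
noncomputable def subst {K : Type*} [Field K] {n : ℕ}
    (A : Matrix (Fin (n + 1)) (Fin (n + 1)) K) : Form K n →ₐ[K] Form K n :=
  aeval fun i => ∑ j, C (A i j) * X j

theorem subst_isHomogeneous {K : Type*} [Field K] {n d : ℕ}
    (A : Matrix (Fin (n + 1)) (Fin (n + 1)) K) {f : Form K n} (hf : f.IsHomogeneous d) :
    (subst A f).IsHomogeneous d := by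
  have h := hf.aeval (n := 1) (fun i => ∑ j, C (A i j) * X j : Fin (n + 1) → Form K n)
    (fun i => IsHomogeneous.sum _ _ _ fun j _ => isHomogeneous_C_mul_X _ _)
  simpa [subst] using h

theorem subst_subst {K : Type*} [Field K] {n : ℕ}
    (A B : Matrix (Fin (n + 1)) (Fin (n + 1)) K) (f : Form K n) :
    subst A (subst B f) = subst (B * A) f := by
  have h : (subst A).comp (subst B) = subst (B * A) := by
    apply MvPolynomial.algHom_ext
    intro i
    simp only [AlgHom.comp_apply, subst, aeval_X, map_sum, map_mul, Matrix.mul_apply,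
      Finset.sum_mul, Finset.mul_sum, ← MvPolynomial.algebraMap_eq, AlgHom.commutes]
    rw [Finset.sum_comm]
    simp only [mul_assoc]
  exact DFunLike.congr_fun h f

theorem subst_one {K : Type*} [Field K] {n : ℕ} (f : Form K n) :
    subst (1 : Matrix (Fin (n + 1)) (Fin (n + 1)) K) f = f := by
  have h : subst (1 : Matrix (Fin (n + 1)) (Fin (n + 1)) K) = AlgHom.id K (Form K n) := by
    apply MvPolynomial.algHom_ext
    intro i
    rw [subst, aeval_X, Finset.sum_eq_single i]
    · simp
    · intro j _ hj
      simp [Matrix.one_apply_ne hj.symm]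
    · simp
  rw [h]
  rfl

theorem subst_injective {K : Type*} [Field K] {n : ℕ}
    (A : Matrix.SpecialLinearGroup (Fin (n + 1)) K) :
    Function.Injective (subst (A : Matrix (Fin (n + 1)) (Fin (n + 1)) K)) := by
  apply Function.LeftInverse.injective
    (g := subst ((A⁻¹ : Matrix.SpecialLinearGroup (Fin (n + 1)) K) :
      Matrix (Fin (n + 1)) (Fin (n + 1)) K))
  intro f
  rw [subst_subst, ← Matrix.SpecialLinearGroup.coe_mul, mul_inv_cancel,
    Matrix.SpecialLinearGroup.coe_one, subst_one]

/-- The Grassmannian `Gr(k, H⁰(ℙⁿ, 𝒪(d)))`: its points are the `k`-dimensional linear systems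
of forms of degree `d`.  A point with basis `f_1, …, f_k` stands for the intersection
`{f_1 = ⋯ = f_k = 0}`; for `d = k = 1` it is a hyperplane. -/
structure Gr (K : Type*) [Field K] (n d k : ℕ) where
  space : Submodule K (Form K n)
  le_homogeneous : space ≤ homogeneousSubmodule (Fin (n + 1)) K d
  finrank_eq : Module.finrank K space = k

/-- `f` is a basis of the linear system, so that `f_1 ∧ ⋯ ∧ f_k` is a lift of the point to
`⋀ᵏ H⁰(ℙⁿ, 𝒪(d))`. -/
def Gr.IsFrame {K : Type*} [Field K] {n d k : ℕ} (Φ : Gr K n d k) (f : Fin k → Form K n) : Prop :=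
  Submodule.span K (Set.range f) = Φ.space

/-- The action of `SL(n+1)` by `(A · f)(x) = f(A x)` on the Grassmannian. -/
noncomputable def Gr.act {K : Type*} [Field K] {n d k : ℕ}
    (A : Matrix.SpecialLinearGroup (Fin (n + 1)) K) (Φ : Gr K n d k) : Gr K n d k where
  space := Φ.space.map (subst (A : Matrix (Fin (n + 1)) (Fin (n + 1)) K)).toLinearMap
  le_homogeneous := by
    rintro _ ⟨f, hf, rfl⟩
    exact subst_isHomogeneous _ (Φ.le_homogeneous hf)
  finrank_eq :=
    (LinearEquiv.finrank_eq (Submodule.equivMapOfInjective _ (subst_injective A) Φ.space)).symm.trans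
      Φ.finrank_eq

/-- The parameter space `ℛ = Gr(k, H⁰(𝒪(d))) × Gr(1, H⁰(𝒪(1)))` of pairs `(S, H)`. -/
@[ext]
structure Pair (K : Type*) [Field K] (n d k : ℕ) where
  S : Gr K n d k
  H : Gr K n 1 1

/-- The diagonal action of `SL(n+1)` on pairs. -/
noncomputable def Pair.act {K : Type*} [Field K] {n d k : ℕ}
    (A : Matrix.SpecialLinearGroup (Fin (n + 1)) K) (p : Pair K n d k) : Pair K n d k :=
  ⟨p.S.act A, p.H.act A⟩

/-- The `SL(n+1)`-orbit of a pair. -/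
def Pair.orbit {K : Type*} [Field K] {n d k : ℕ} (p : Pair K n d k) : Set (Pair K n d k) :=
  {q | ∃ A : Matrix.SpecialLinearGroup (Fin (n + 1)) K, q = p.act A}

/-! ### The Hilbert–Mumford function -/

/-- The weights of the one-parameter subgroup `diag(s^{r_0}, …, s^{r_n})` on the monomials
`x^{I_1} ∧ ⋯ ∧ x^{I_k}` that occur in `f_1 ∧ ⋯ ∧ f_k`, i.e. whose Plücker coordinate is nonzero. -/
def Gr.weights {K : Type*} [Field K] {n d k : ℕ} (Φ : Gr K n d k) (r : Fin (n + 1) → ℤ) : Set ℤ :=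
  {w | ∃ (f : Fin k → Form K n) (I : Fin k → Mon n d), Φ.IsFrame f ∧
    (Matrix.of fun i j : Fin k => coeff (I j : Fin (n + 1) →₀ ℕ) (f i)).det ≠ 0 ∧
    w = ∑ j, ∑ i, ((I j : Fin (n + 1) →₀ ℕ) i : ℤ) * r i}

/-- The Hilbert–Mumford function `μ(f_1 ∧ ⋯ ∧ f_k, λ)`: the largest weight that occurs
(`weights` is a nonempty finite set). -/
noncomputable def Gr.mu {K : Type*} [Field K] {n d k : ℕ} (Φ : Gr K n d k)
    (r : Fin (n + 1) → ℤ) : ℤ :=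
  sSup (Φ.weights r)

/-- `μ_t(S, H, λ) = μ(S, λ) + t μ(H, λ)`. -/
noncomputable def Pair.mu {K : Type*} [Field K] {n d k : ℕ} (t : ℚ) (p : Pair K n d k)
    (r : Fin (n + 1) → ℤ) : ℚ :=
  (p.S.mu r : ℚ) + t * (p.H.mu r : ℚ)

/-- `t`-semistability: `μ_t(S, H, λ) ≥ 0` for all nontrivial one-parameter subgroups `λ` of
`SL(n+1)`.  Every such `λ` is, in suitable coordinates, a normalised diagonal one:
`diag(s^{r_0}, …, s^{r_n})` with `r_0 ≥ ⋯ ≥ r_n` and `∑ r_i = 0`. -/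
def Pair.IsSemistable {K : Type*} [Field K] {n d k : ℕ} (t : ℚ) (p : Pair K n d k) : Prop :=
  ∀ (A : Matrix.SpecialLinearGroup (Fin (n + 1)) K) (r : Fin (n + 1) → ℤ),
    Antitone r → ∑ i, r i = 0 → r ≠ 0 → 0 ≤ (p.act A).mu t r

/-! ### Sections of line bundles on `ℛ`, the Zariski topology, and the quotient -/

/-- Indices of the coefficients of a tuple `(f_1, …, f_k, h)` of `k` forms of degree `d` and a
linear form. -/
abbrev CoeffIndex (n d k : ℕ) : Type := (Fin k × Mon n d) ⊕ Mon n 1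

/-- The coefficients of the tuple `(f_1, …, f_k, h)`. -/
noncomputable def coeffs {K : Type*} [Field K] {n d k : ℕ} (f : Fin k → Form K n) (h : Form K n) :
    CoeffIndex n d k → K :=
  Sum.elim (fun a => coeff (a.2 : Fin (n + 1) →₀ ℕ) (f a.1))
    (fun J => coeff (J : Fin (n + 1) →₀ ℕ) h)

/-- `F`, a polynomial in the coefficients of `(f_1, …, f_k, h)`, is a section of the line bundle
`𝒪(m, l)` on `ℛ`: it transforms by `det(M)^m c^l` when the basis `f_1, …, f_k` is changed by
`M ∈ GL_k` and `h` is multiplied by `c`. -/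
def IsSection {K : Type*} [Field K] {n d k : ℕ} (m l : ℕ)
    (F : MvPolynomial (CoeffIndex n d k) K) : Prop :=
  ∀ (f : Fin k → Form K n) (h : Form K n) (M : Matrix (Fin k) (Fin k) K) (c : K),
    M.det ≠ 0 → c ≠ 0 →
    eval (coeffs (fun i => ∑ j, M i j • f j) (c • h)) F
      = M.det ^ m * c ^ l * eval (coeffs f h) F

/-- `F` is invariant under `SL(n+1)`. -/
def IsInvariant {K : Type*} [Field K] {n d k : ℕ}
    (F : MvPolynomial (CoeffIndex n d k) K) : Prop :=
  ∀ (A : Matrix.SpecialLinearGroup (Fin (n + 1)) K) (f : Fin k → Form K n) (h : Form K n),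
    (∀ i, (f i).IsHomogeneous d) → h.IsHomogeneous 1 →
    eval (coeffs (fun i => subst (A : Matrix (Fin (n + 1)) (Fin (n + 1)) K) (f i))
      (subst (A : Matrix (Fin (n + 1)) (Fin (n + 1)) K) h)) F = eval (coeffs f h) F

/-- The section `F` vanishes at the pair `p`. -/
def Pair.Vanishes {K : Type*} [Field K] {n d k : ℕ} (p : Pair K n d k)
    (F : MvPolynomial (CoeffIndex n d k) K) : Prop :=
  ∀ (f : Fin k → Form K n) (h : Form K n), p.S.IsFrame f → Submodule.span K {h} = p.H.space →
    eval (coeffs f h) F = 0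

/-- The Zariski closed subsets of `ℛ`: common zero loci of sections of the bundles `𝒪(m, l)`. -/
def IsZariskiClosed {K : Type*} [Field K] {n d k : ℕ} (Z : Set (Pair K n d k)) : Prop :=
  ∃ T : Set (MvPolynomial (CoeffIndex n d k) K),
    (∀ F ∈ T, ∃ m l : ℕ, IsSection m l F) ∧ Z = {p | ∀ F ∈ T, p.Vanishes F}

/-- The homogeneous elements of degree `m` of the graded ring `⨁ H⁰(ℛ, ℒ^j)^{SL(n+1)}` for
`ℒ = 𝒪(a, b)`, `t = b / a`: invariant sections of `𝒪(m, t m)`. -/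
def IsInvariantSection {K : Type*} [Field K] {n d k : ℕ} (t : ℚ) (m : ℕ)
    (F : MvPolynomial (CoeffIndex n d k) K) : Prop :=
  IsInvariant F ∧ ∃ l : ℕ, (l : ℚ) = t * m ∧ IsSection m l F

/-- The locus in `ℛ` where some invariant section of positive degree does not vanish, i.e. where
the rational map from `ℛ` to `Proj ⨁ H⁰(ℛ, ℒ^j)^{SL(n+1)}` is defined. -/
def semistableLocus (K : Type*) [Field K] (n d k : ℕ) (t : ℚ) : Set (Pair K n d k) :=
  {p | ∃ (m : ℕ) (F : MvPolynomial (CoeffIndex n d k) K),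
    0 < m ∧ IsInvariantSection t m F ∧ ¬ p.Vanishes F}

/-- Two points of the semistable locus have the same image in `Proj ⨁ H⁰(ℛ, ℒ^j)^{SL(n+1)}` iff
the same homogeneous invariants vanish at them (a point of `Proj` is a homogeneous ideal). -/
def quotientSetoid (K : Type*) [Field K] (n d k : ℕ) (t : ℚ) :
    Setoid (semistableLocus K n d k t) where
  r p q := ∀ (m : ℕ) (F : MvPolynomial (CoeffIndex n d k) K), IsInvariantSection t m F →
    (p.1.Vanishes F ↔ q.1.Vanishes F)
  iseqv :=
    ⟨fun _ _ _ _ => Iff.rfl, fun h m F hF => (h m F hF).symm,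
      fun h₁ h₂ m F hF => (h₁ m F hF).trans (h₂ m F hF)⟩

/-- The (closed) points of the VGIT quotient
`M^GIT_{n,d,k}(t) = ℛ // SL(n+1) = Proj ⨁ H⁰(ℛ, ℒ^j)^{SL(n+1)}`: the images of the points of the
semistable locus. -/
def GITQuotient (K : Type*) [Field K] (n d k : ℕ) (t : ℚ) : Type _ :=
  Quotient (quotientSetoid K n d k t)

/-- The quotient map from the semistable locus to `M^GIT_{n,d,k}(t)`. -/
def toQuotient {K : Type*} [Field K] {n d k : ℕ} {t : ℚ} (p : semistableLocus K n d k t) :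
    GITQuotient K n d k t :=
  Quotient.mk (quotientSetoid K n d k t) p

/-- The orbit of `p` is closed in the semistable locus. -/
def Pair.HasClosedOrbit {K : Type*} [Field K] {n d k : ℕ} (t : ℚ) (p : Pair K n d k) : Prop :=
  ∃ Z : Set (Pair K n d k), IsZariskiClosed Z ∧ p.orbit = Z ∩ semistableLocus K n d k t

/-! ### Geometry of pairs -/

/-- The homogeneous ideal `(f_1, …, f_k)` of `S = {f_1 = ⋯ = f_k = 0}`. -/
noncomputable def Gr.ideal {K : Type*} [Field K] {n d k : ℕ} (Φ : Gr K n d k) : Ideal (Form K n) :=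
  Ideal.span (Φ.space : Set (Form K n))

/-- The homogeneous ideal `(f_1, …, f_k, h)` of `D = S ∩ H`. -/
noncomputable def Pair.idealD {K : Type*} [Field K] {n d k : ℕ} (p : Pair K n d k) : Ideal (Form K n) :=
  p.S.ideal ⊔ p.H.ideal

/-- `S` is a complete intersection of `k` hypersurfaces: it has codimension `k`. -/
def Gr.IsCompleteIntersection {K : Type*} [Field K] {n d k : ℕ} (Φ : Gr K n d k) : Prop :=
  Φ.ideal.height = k

/-- `S` is a variety (integral). -/
def Gr.IsVariety {K : Type*} [Field K] {n d k : ℕ} (Φ : Gr K n d k) : Prop :=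
  Φ.ideal.IsPrime

/-- The hypersurface `{f = 0}` does not contain the hyperplane `{l = 0}` in its support, for
any hypersurface `{f = 0}` of the linear system and any equation `l` of the hyperplane. -/
def Gr.NoMemberContains {K : Type*} [Field K] {n d k : ℕ} (Φ : Gr K n d k) (L : Gr K n 1 1) :
    Prop :=
  ∀ f ∈ Φ.space, f ≠ 0 → ∀ l ∈ L.space, l ≠ 0 → ¬ l ∣ f

/-- `D = S ∩ H` is a divisor on `S`, i.e. `H` contains no irreducible component of `S`, and `D` is
itself a complete intersection, of codimension `k + 1` in projective space
(of codimension `k` in `H`). -/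
def Pair.IsDivisorCompleteIntersection {K : Type*} [Field K] {n d k : ℕ} (p : Pair K n d k) :
    Prop :=
  (∀ P ∈ p.S.ideal.minimalPrimes, ¬ p.H.ideal ≤ P) ∧ p.idealD.height = (k + 1 : ℕ)

end VGIT

/-!
Both notions of semistability give one inequality, `Pair.HasNonnegBounds`: whenever the members of
a basis of the linear system and the equation of the hyperplane have weights at most `w_i` and `v`
for a one-parameter subgroup, `∑ w_i + t v ≥ 0`.  For the numerical notion this is the definition of
the Hilbert–Mumford function; for the semistable locus it is the easy half of the Hilbert–Mumford
criterion (`hasNonnegBounds_of_mem_semistableLocus`), since an invariant section would otherwise tend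
to zero along the subgroup.  The converse half is never needed.

The statements about hyperplanes follow from the subgroup with weights `(1, …, 1, -n)`: a form of
degree `d` divisible by `x_n` has weight at most `d - (n + 1)`.  For the divisor `D`, Krull's height
theorem reduces everything to `H` containing no component `P` of `S`.  If `S` is integral, its ideal
contains no linear form as `d > 1`; if `k = 1`, a component inside `H` equals `H`, so that `H` lies in
the only member; if `k = d = 2`, the two quadrics restricted to `H` have a common linear factor
(`exists_linear_of_mem_minimalPrimes`), so `S ∩ H` contains a linear subspace of codimension two,
which is destabilised by the weights `(2, …, 2, -(n - 1), -(n - 1))`.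

For closed orbits (`exists_hasClosedOrbit`), the fibres of the quotient map are closed in the
semistable locus because the points of `Proj` in question are maximal ideals.  In a fibre take an
orbit whose cone in the Segre–Plücker embedding has maximal vanishing ideal.  An orbit in its closure
has the same vanishing ideal, and by Chevalley's theorem each orbit contains a nonempty open subset of
its closure, so the two orbits meet.
-/

namespace VGIT

open MvPolynomial

/-! ### Bases of linear systems -/

/-- The group `SL(n+1)` acting on pairs. -/
abbrev SL (K : Type*) [Field K] (n : ℕ) : Type _ := Matrix.SpecialLinearGroup (Fin (n + 1)) K

variable {K : Type*} [Field K] {n d k : ℕ}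

theorem Gr.ext_space {Φ Ψ : Gr K n d k} (h : Φ.space = Ψ.space) : Φ = Ψ := by
  cases Φ; cases Ψ; simp only [Gr.mk.injEq]; exact h

theorem Gr.IsFrame.linearIndependent {Φ : Gr K n d k} {f : Fin k → Form K n} (hf : Φ.IsFrame f) :
    LinearIndependent K f := by
  rw [linearIndependent_iff_card_eq_finrank_span, Set.finrank, hf, Φ.finrank_eq, Fintype.card_fin]

theorem Gr.IsFrame.mem {Φ : Gr K n d k} {f : Fin k → Form K n} (hf : Φ.IsFrame f) (i : Fin k) :
    f i ∈ Φ.space :=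
  hf ▸ Submodule.subset_span ⟨i, rfl⟩

theorem Gr.isHomogeneous {Φ : Gr K n d k} {f : Form K n} (hf : f ∈ Φ.space) :
    f.IsHomogeneous d :=
  (mem_homogeneousSubmodule _ _).1 (Φ.le_homogeneous hf)

theorem Gr.IsFrame.isHomogeneous {Φ : Gr K n d k} {f : Fin k → Form K n} (hf : Φ.IsFrame f)
    (i : Fin k) : (f i).IsHomogeneous d :=
  Gr.isHomogeneous (hf.mem i)

theorem Gr.isFrame_of_linearIndependent {Φ : Gr K n d k} (hk : k ≠ 0) {f : Fin k → Form K n}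
    (hf : LinearIndependent K f) (hmem : ∀ i, f i ∈ Φ.space) : Φ.IsFrame f := by
  have : FiniteDimensional K Φ.space :=
    Module.finite_of_finrank_pos (by rw [Φ.finrank_eq]; omega)
  apply Submodule.eq_of_le_of_finrank_eq
  · rw [Submodule.span_le]
    rintro _ ⟨i, rfl⟩
    exact hmem i
  · rw [finrank_span_eq_card hf, Φ.finrank_eq, Fintype.card_fin]

theorem Gr.exists_isFrame_apply_eq (Φ : Gr K n d k) (hk : k ≠ 0) {g : Form K n}
    (hg : g ∈ Φ.space) (hg0 : g ≠ 0) :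
    ∃ (f : Fin k → Form K n) (i : Fin k), Φ.IsFrame f ∧ f i = g := by
  have : FiniteDimensional K Φ.space :=
    Module.finite_of_finrank_pos (by rw [Φ.finrank_eq]; omega)
  let g' : Φ.space := ⟨g, hg⟩
  have hli : LinearIndepOn K id ({g'} : Set Φ.space) := by
    apply LinearIndepOn.singleton
    intro h
    exact hg0 (congrArg Subtype.val h)
  let b := Module.Basis.extend hli
  have hmem : g' ∈ hli.extend (Set.subset_univ _) := hli.subset_extend _ rfl
  have hfin : Fintype (hli.extend (Set.subset_univ _)) := FiniteDimensional.fintypeBasisIndex b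
  have hcard : Fintype.card (hli.extend (Set.subset_univ _)) = k := by
    rw [← Module.finrank_eq_card_basis b, Φ.finrank_eq]
  let e := Fintype.equivFinOfCardEq hcard
  refine ⟨fun i => (b (e.symm i) : Form K n), e ⟨g', hmem⟩, ?_, ?_⟩
  · apply Gr.isFrame_of_linearIndependent hk
    · exact (b.linearIndependent.comp _ e.symm.injective).map' Φ.space.subtype
        (Submodule.ker_subtype _)
    · intro i
      exact (b (e.symm i)).2
  · simp [b, g']

theorem Gr.exists_ne_zero (Φ : Gr K n d k) (hk : k ≠ 0) : ∃ g ∈ Φ.space, g ≠ 0 := by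
  by_contra! h
  apply hk
  rw [← Φ.finrank_eq, (Submodule.eq_bot_iff _).2 h]
  simp

theorem Gr.exists_isFrame (Φ : Gr K n d k) (hk : k ≠ 0) : ∃ f, Φ.IsFrame f := by
  obtain ⟨g, hg, hg0⟩ := Φ.exists_ne_zero hk
  obtain ⟨f, -, hf, -⟩ := Φ.exists_isFrame_apply_eq hk hg hg0
  exact ⟨f, hf⟩

theorem Gr.IsFrame.act {Φ : Gr K n d k} {f : Fin k → Form K n} (hf : Φ.IsFrame f)
    (A : SL K n) :
    (Φ.act A).IsFrame fun i => subst A.1 (f i) := by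
  change _ = Φ.space.map _
  rw [← hf, Submodule.map_span, ← Set.range_comp]
  rfl

theorem Gr.IsFrame.exists_matrix {Φ : Gr K n d k} {f g : Fin k → Form K n} (hf : Φ.IsFrame f)
    (hg : Φ.IsFrame g) :
    ∃ M : Matrix (Fin k) (Fin k) K, M.det ≠ 0 ∧ g = fun i => ∑ j, M i j • f j := by
  have h (i : Fin k) : ∃ c : Fin k → K, ∑ j, c j • f j = g i :=
    (Submodule.mem_span_range_iff_exists_fun K).1 (hf.symm ▸ hg.mem i)
  choose M hM using h
  refine ⟨Matrix.of M, fun hdet => ?_, funext fun i => (hM i).symm⟩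
  obtain ⟨v, hv0, hv⟩ := Matrix.exists_vecMul_eq_zero_iff.2 hdet
  apply hv0
  have hsum : ∑ i, v i • g i = 0 := by
    simp_rw [← hM, Finset.smul_sum, smul_smul]
    rw [Finset.sum_comm]
    simp_rw [← Finset.sum_smul]
    apply Finset.sum_eq_zero
    intro j _
    have := congrFun hv j
    simp only [Matrix.vecMul, dotProduct, Matrix.of_apply, Pi.zero_apply] at this
    rw [this, zero_smul]
  exact funext (Fintype.linearIndependent_iff.1 hg.linearIndependent v hsum)

theorem Gr.isFrame_const_iff {H : Gr K n d 1} {h : Form K n} :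
    H.IsFrame (fun _ => h) ↔ Submodule.span K {h} = H.space := by
  rw [Gr.IsFrame, Set.range_const]

theorem Gr.ne_zero_of_span_eq {H : Gr K n d 1} {h : Form K n}
    (hh : Submodule.span K {h} = H.space) : h ≠ 0 :=
  (Gr.isFrame_const_iff.2 hh).linearIndependent.ne_zero 0

theorem Gr.span_eq_of_mem {H : Gr K n d 1} {h : Form K n} (hh : h ∈ H.space) (h0 : h ≠ 0) :
    Submodule.span K {h} = H.space := by
  rw [← Gr.isFrame_const_iff]
  apply Gr.isFrame_of_linearIndependent one_ne_zero _ fun _ => hh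
  exact LinearIndependent.of_subsingleton 0 h0

theorem Gr.exists_span_eq (H : Gr K n d 1) : ∃ h, Submodule.span K {h} = H.space := by
  obtain ⟨h, hh, h0⟩ := H.exists_ne_zero one_ne_zero
  exact ⟨h, Gr.span_eq_of_mem hh h0⟩

theorem Gr.span_act {H : Gr K n d 1} {h : Form K n} (hh : Submodule.span K {h} = H.space)
    (A : SL K n) :
    Submodule.span K {subst A.1 h} = (H.act A).space :=
  Gr.isFrame_const_iff.1 ((Gr.isFrame_const_iff.2 hh).act A)

theorem Gr.act_mul (A B : SL K n) (Φ : Gr K n d k) :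
    (Φ.act B).act A = Φ.act (B * A) := by
  apply Gr.ext_space
  change (Φ.space.map (subst B.1).toLinearMap).map (subst A.1).toLinearMap
    = Φ.space.map (subst (B * A).1).toLinearMap
  rw [← Submodule.map_comp]
  congr 1
  exact LinearMap.ext fun f => subst_subst _ _ f

theorem Gr.act_one (Φ : Gr K n d k) : Φ.act 1 = Φ := by
  apply Gr.ext_space
  change Φ.space.map (subst (1 : SL K n).1).toLinearMap = Φ.space
  have : (subst (1 : SL K n).1).toLinearMap = LinearMap.id := LinearMap.ext fun f => subst_one f
  rw [this, Submodule.map_id]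

theorem Pair.act_mul (A B : SL K n) (p : Pair K n d k) :
    (p.act B).act A = p.act (B * A) := by
  simp only [Pair.act, Gr.act_mul]

theorem Pair.act_one (p : Pair K n d k) : p.act 1 = p := by
  simp only [Pair.act, Gr.act_one]

theorem exists_minor_ne_zero {ι : Type*} {k : ℕ} {v : Fin k → ι → K} [Finite ι]
    (hv : LinearIndependent K v) : ∃ I : Fin k → ι, (Matrix.of fun i j => v i (I j)).det ≠ 0 := by
  have := Fintype.ofFinite ι
  have hrank : (Matrix.of v).rank = k := by
    simpa using LinearIndependent.rank_matrix (M := Matrix.of v) hv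
  rw [Matrix.rank_eq_finrank_span_cols] at hrank
  obtain ⟨s, hs, hspan, hli⟩ := exists_linearIndependent K (Set.range (Matrix.of v).col)
  have hfin : Finite s := (Set.finite_range _).subset hs
  have := Fintype.ofFinite s
  have hcard : Fintype.card s = k := by
    have := finrank_span_eq_card hli
    rw [Subtype.range_coe, hspan] at this
    exact this.symm.trans hrank
  let e := Fintype.equivFinOfCardEq hcard
  have hch (j : Fin k) : ∃ i : ι, (Matrix.of v).col i = (e.symm j : Fin k → K) := hs (e.symm j).2
  choose I hI using hch
  refine ⟨I, ?_⟩
  have hli' : LinearIndependent K (fun j => (Matrix.of v).col (I j)) := by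
    simp_rw [hI]
    exact hli.comp _ e.symm.injective
  intro hdet
  obtain ⟨c, hc0, hc⟩ := Matrix.exists_mulVec_eq_zero_iff.2 hdet
  apply hc0
  refine funext (Fintype.linearIndependent_iff.1 hli' c ?_)
  ext i
  have := congrFun hc i
  simpa [Matrix.mulVec, dotProduct, mul_comm] using this

theorem mem_mon_iff {I : Fin (n + 1) →₀ ℕ} :
    I ∈ Finset.finsuppAntidiag (Finset.univ : Finset (Fin (n + 1))) d ↔ I.degree = d := by
  simp [Finset.mem_finsuppAntidiag, Finsupp.degree_eq_sum]

theorem eq_of_coeff_mon_eq {f g : Form K n} (hf : f.IsHomogeneous d) (hg : g.IsHomogeneous d)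
    (h : ∀ I : Mon n d, coeff (I : Fin (n + 1) →₀ ℕ) f = coeff (I : Fin (n + 1) →₀ ℕ) g) :
    f = g := by
  ext I
  by_cases hI : I.degree = d
  · exact h ⟨I, mem_mon_iff.2 hI⟩
  · rw [hf.coeff_eq_zero hI, hg.coeff_eq_zero hI]

/-- Some Plücker coordinate of a linear system is nonzero. -/
theorem Gr.IsFrame.exists_minor_ne_zero {Φ : Gr K n d k} {f : Fin k → Form K n}
    (hf : Φ.IsFrame f) : ∃ I : Fin k → Mon n d,
      (Matrix.of fun i j : Fin k => coeff (I j : Fin (n + 1) →₀ ℕ) (f i)).det ≠ 0 := by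
  apply VGIT.exists_minor_ne_zero (v := fun i (J : Mon n d) => coeff (J : Fin (n + 1) →₀ ℕ) (f i))
  rw [Fintype.linearIndependent_iff]
  intro c hc
  apply Fintype.linearIndependent_iff.1 hf.linearIndependent
  apply eq_of_coeff_mon_eq (d := d)
  · exact IsHomogeneous.sum _ _ _ fun i _ => by
      rw [smul_eq_C_mul]; exact (hf.isHomogeneous i).C_mul _
  · exact isHomogeneous_zero _ _ _
  · intro I
    have := congrFun hc I
    simpa [coeff_sum] using this

/-! ### Weight bounds and semistability -/

/-- All monomials of `f` have weight at most `w` for the one-parameter subgroup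
`diag(s^{r_0}, …, s^{r_n})`. -/
def WeightLE (r : Fin (n + 1) → ℤ) (w : ℤ) (f : Form K n) : Prop :=
  ∀ I, coeff I f ≠ 0 → ∑ i, (I i : ℤ) * r i ≤ w

theorem Gr.mu_le {Φ : Gr K n d k} {r : Fin (n + 1) → ℤ} {f : Fin k → Form K n}
    (hf : Φ.IsFrame f) {w : Fin k → ℤ} (hw : ∀ i, WeightLE r (w i) (f i)) :
    Φ.mu r ≤ ∑ i, w i := by
  apply csSup_le
  · obtain ⟨I, hI⟩ := hf.exists_minor_ne_zero
    exact ⟨_, f, I, hf, hI, rfl⟩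
  · rintro _ ⟨g, I, hg, hI, rfl⟩
    obtain ⟨M, -, rfl⟩ := hf.exists_matrix hg
    have hmul : (Matrix.of fun i j : Fin k =>
        coeff (I j : Fin (n + 1) →₀ ℕ) ((fun i => ∑ j, M i j • f j) i))
        = M * Matrix.of fun i j : Fin k => coeff (I j : Fin (n + 1) →₀ ℕ) (f i) := by
      ext i j
      simp [Matrix.mul_apply, coeff_sum]
    rw [hmul, Matrix.det_mul] at hI
    have hdet := right_ne_zero_of_mul hI
    rw [Matrix.det_apply] at hdet
    obtain ⟨σ, -, hσ⟩ := Finset.exists_ne_zero_of_sum_ne_zero hdet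
    have hprod : ∏ j, coeff (I j : Fin (n + 1) →₀ ℕ) (f (σ j)) ≠ 0 := fun h => hσ (by simp [h])
    rw [Finset.prod_ne_zero_iff] at hprod
    calc ∑ j, ∑ i, ((I j : Fin (n + 1) →₀ ℕ) i : ℤ) * r i
        ≤ ∑ j, w (σ j) := Finset.sum_le_sum fun j hj => hw (σ j) _ (hprod j hj)
      _ = ∑ i, w i := Equiv.sum_comp σ w

/-- The inequality that both notions of semistability provide, in the form in which it destabilises:
weight bounds for the members of a basis of the linear system and for the equation of the
hyperplane have nonnegative (weighted) sum. -/
def Pair.HasNonnegBounds (t : ℚ) (p : Pair K n d k) : Prop :=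
  ∀ (A : SL K n) (r : Fin (n + 1) → ℤ), Antitone r → ∑ i, r i = 0 → r ≠ 0 →
    ∀ (f : Fin k → Form K n) (h : Form K n) (w : Fin k → ℤ) (v : ℤ),
      (p.act A).S.IsFrame f → Submodule.span K {h} = (p.act A).H.space →
      (∀ i, WeightLE r (w i) (f i)) → WeightLE r v h → 0 ≤ (∑ i, w i : ℤ) + t * (v : ℚ)

theorem Pair.IsSemistable.hasNonnegBounds {t : ℚ} (ht : 0 ≤ t) {p : Pair K n d k}
    (hp : p.IsSemistable t) : p.HasNonnegBounds t := by
  intro A r hr hr0 hrne f h w v hf hh hw hv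
  have h1 : ((p.act A).S.mu r : ℚ) ≤ (∑ i, w i : ℤ) := by
    exact_mod_cast Gr.mu_le hf hw
  have h2 : ((p.act A).H.mu r : ℚ) ≤ v := by
    have := Gr.mu_le (Gr.isFrame_const_iff.2 hh) (w := fun _ => v) fun _ => hv
    simp only [Finset.univ_unique, Finset.sum_const, Finset.card_singleton, one_smul] at this
    exact_mod_cast this
  calc (0 : ℚ) ≤ (p.act A).mu t r := hp A r hr hr0 hrne
    _ ≤ _ := add_le_add h1 (mul_le_mul_of_nonneg_left h2 ht)

theorem prod_zpow_eq {ι : Type*} {u : K} (hu : u ≠ 0) (s : Finset ι) (a : ι → ℤ) :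
    ∏ i ∈ s, u ^ a i = u ^ (∑ i ∈ s, a i) := by
  induction s using Finset.cons_induction with
  | empty => simp
  | cons a s ha ih => rw [Finset.prod_cons, Finset.sum_cons, ih, zpow_add₀ hu]

theorem coeff_subst_diagonal (a : Fin (n + 1) → K) (f : Form K n) (I : Fin (n + 1) →₀ ℕ) :
    coeff I (subst (Matrix.diagonal a) f) = (∏ i, a i ^ I i) * coeff I f := by
  have hX (i : Fin (n + 1)) : ∑ j, C (Matrix.diagonal a i j) * X j = C (a i) * (X i : Form K n) := by
    rw [Finset.sum_eq_single i]
    · simp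
    · intro j _ hj
      simp [Matrix.diagonal_apply_ne _ hj.symm]
    · simp
  induction f using MvPolynomial.induction_on' with
  | monomial J c =>
    have : subst (Matrix.diagonal a) (monomial J c) = monomial J ((∏ i, a i ^ J i) * c) := by
      simp only [subst, hX, aeval_monomial]
      rw [monomial_eq (a := _ * _), Finsupp.prod_fintype _ _ fun _ => pow_zero _,
        Finsupp.prod_fintype _ _ fun _ => pow_zero _]
      simp only [map_mul, map_prod, map_pow, algebraMap_eq, mul_pow, Finset.prod_mul_distrib]
      ring
    rw [this, coeff_monomial, coeff_monomial]
    split_ifs with h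
    · rw [h]
    · simp
  | add f g hf hg => rw [map_add, coeff_add, hf, hg, coeff_add, mul_add]

theorem IsSection.eval_ne_zero {m l : ℕ} {F : MvPolynomial (CoeffIndex n d k) K}
    (hF : IsSection m l F) {p : Pair K n d k} {f f' : Fin k → Form K n} {h h' : Form K n}
    (hf : p.S.IsFrame f) (hf' : p.S.IsFrame f') (hh : Submodule.span K {h} = p.H.space)
    (hh' : Submodule.span K {h'} = p.H.space) (h0 : eval (coeffs f h) F ≠ 0) :
    eval (coeffs f' h') F ≠ 0 := by
  obtain ⟨M, hM, rfl⟩ := hf.exists_matrix hf'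
  have hmem : h' ∈ Submodule.span K {h} := by
    rw [hh, ← hh']; exact Submodule.mem_span_singleton_self _
  obtain ⟨c, rfl⟩ := Submodule.mem_span_singleton.1 hmem
  have hc : c ≠ 0 := by
    rintro rfl
    exact Gr.ne_zero_of_span_eq hh' (zero_smul _ _)
  rw [hF f h M c hM hc]
  exact mul_ne_zero (mul_ne_zero (pow_ne_zero _ hM) (pow_ne_zero _ hc)) h0

theorem IsSection.vanishes_iff {m l : ℕ} {F : MvPolynomial (CoeffIndex n d k) K}
    (hF : IsSection m l F) {p : Pair K n d k} {f : Fin k → Form K n} {h : Form K n}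
    (hf : p.S.IsFrame f) (hh : Submodule.span K {h} = p.H.space) :
    p.Vanishes F ↔ eval (coeffs f h) F = 0 := by
  refine ⟨fun hv => hv f h hf hh, fun h0 f' h' hf' hh' => ?_⟩
  by_contra hne
  exact hF.eval_ne_zero hf' hf hh' hh hne h0

theorem IsInvariant.vanishes_act_iff {m l : ℕ} {F : MvPolynomial (CoeffIndex n d k) K}
    (hF : IsInvariant F) (hs : IsSection m l F) (hk : k ≠ 0) (p : Pair K n d k) (A : SL K n) :
    (p.act A).Vanishes F ↔ p.Vanishes F := by
  obtain ⟨f, hf⟩ := p.S.exists_isFrame hk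
  obtain ⟨h, hh⟩ := p.H.exists_span_eq
  rw [hs.vanishes_iff hf hh, hs.vanishes_iff (p := p.act A) (hf.act A) (Gr.span_act hh A),
    hF A f h hf.isHomogeneous (Gr.isHomogeneous (hh ▸ Submodule.mem_span_singleton_self h))]

/-- The easy half of the Hilbert–Mumford criterion: if a pair had negative weight bounds, every
invariant section would tend to `0` along the one-parameter subgroup. -/
theorem hasNonnegBounds_of_mem_semistableLocus [Infinite K] (hk : k ≠ 0) {t : ℚ} {p : Pair K n d k}
    (hp : p ∈ semistableLocus K n d k t) : p.HasNonnegBounds t := by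
  obtain ⟨m, F, hm, ⟨hinv, l, hl, hs⟩, hFp⟩ := hp
  intro A r hr hr0 hrne f h w v hf hh hw hv
  rw [← hinv.vanishes_act_iff hs hk p A, hs.vanishes_iff hf hh] at hFp
  have hfh := hf.isHomogeneous
  have hhh : h.IsHomogeneous 1 := Gr.isHomogeneous (hh ▸ Submodule.mem_span_singleton_self h)
  let wt (I : Fin (n + 1) →₀ ℕ) : ℤ := ∑ i, (I i : ℤ) * r i
  -- The coordinates of `s^{-w} λ(s) · (f, h)`, as polynomials in `u = s⁻¹`.
  let y : CoeffIndex n d k → Polynomial K :=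
    Sum.elim (fun a => Polynomial.C (coeff (a.2 : Fin (n + 1) →₀ ℕ) (f a.1)) *
        Polynomial.X ^ (w a.1 - wt a.2).toNat)
      (fun J => Polynomial.C (coeff (J : Fin (n + 1) →₀ ℕ) h) * Polynomial.X ^ (v - wt J).toNat)
  let G : Polynomial K := aeval y F
  have hG (u : K) (hu : u ≠ 0) :
      G.eval u = u ^ (m * ∑ i, w i + l * v : ℤ) * eval (coeffs f h) F := by
    obtain ⟨D, hD, hwt⟩ : ∃ D : Matrix (Fin (n + 1)) (Fin (n + 1)) K, D.det = 1 ∧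
        ∀ (g : Form K n) (I : Fin (n + 1) →₀ ℕ),
          coeff I (subst D g) = u ^ (-wt I) * coeff I g := by
      refine ⟨Matrix.diagonal fun i => u ^ (-r i), ?_, fun g I => ?_⟩
      · rw [Matrix.det_diagonal, prod_zpow_eq hu, Finset.sum_neg_distrib, hr0, neg_zero, zpow_zero]
      · rw [coeff_subst_diagonal]
        simp only [← zpow_natCast, ← zpow_mul]
        rw [prod_zpow_eq hu, ← Finset.sum_neg_distrib]
        simp only [neg_mul, mul_comm]
    have key (g : Form K n) (b : ℤ) (hg : WeightLE r b g) (I : Fin (n + 1) →₀ ℕ) :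
        coeff I g * u ^ (b - wt I).toNat = u ^ b * (u ^ (-wt I) * coeff I g) := by
      by_cases h0 : coeff I g = 0
      · simp [h0]
      · have hle : 0 ≤ b - wt I := sub_nonneg.2 (hg I h0)
        rw [← zpow_natCast, Int.toNat_of_nonneg hle, sub_eq_add_neg, zpow_add₀ hu]
        ring
    have h1 : G.eval u = eval (coeffs (fun i => ∑ j, Matrix.diagonal (fun i => u ^ w i) i j •
        subst D (f j))
        (u ^ v • subst D h)) F := by
      have : G.eval u = eval (fun a => (y a).eval u) F := by
        have : (Polynomial.aeval u).comp (aeval y) = aeval (R := K) fun a => (y a).eval u := by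
          ext1 a
          simp
        simpa [G, Polynomial.aeval_def, aeval_def, ← eval₂_id] using DFunLike.congr_fun this F
      rw [this]
      congr 2
      funext a
      rcases a with ⟨i, I⟩ | J
      · simp [y, coeffs, Matrix.diagonal_apply, hwt, key _ _ (hw i)]
      · simp [y, coeffs, hwt, key _ _ hv]
    rw [h1, hs _ _ _ _ _ (zpow_ne_zero _ hu), hinv ⟨_, hD⟩ f h hfh hhh]
    · rw [Matrix.det_diagonal, prod_zpow_eq hu, zpow_add₀ hu, mul_comm (m : ℤ), mul_comm (l : ℤ), zpow_mul, zpow_mul,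
        zpow_natCast, zpow_natCast]
    · rw [Matrix.det_diagonal]
      exact Finset.prod_ne_zero_iff.2 fun i _ => zpow_ne_zero _ hu
  by_contra hneg
  push Not at hneg
  have hm' : (0 : ℚ) < m := by exact_mod_cast hm
  have hN : (m * ∑ i, w i + l * v : ℤ) < 0 := by
    have : ((m * ∑ i, w i + l * v : ℤ) : ℚ) = m * ((∑ i, w i : ℤ) + t * v) := by
      push_cast
      rw [hl]
      ring
    have h2 := mul_neg_of_pos_of_neg hm' hneg
    rw [← this] at h2
    exact_mod_cast h2
  obtain ⟨N, hNeq⟩ := Int.eq_ofNat_of_zero_le (neg_nonneg.2 hN.le)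
  have hN0 : N ≠ 0 := by omega
  have hpoly : Polynomial.X ^ N * G = Polynomial.C (eval (coeffs f h) F) := by
    apply Polynomial.eq_of_infinite_eval_eq
    apply Set.Infinite.mono (s := {0}ᶜ) _ (Set.finite_singleton (0 : K)).infinite_compl
    intro u hu
    have hu : u ≠ 0 := hu
    simp only [Set.mem_ofPred_eq, Polynomial.eval_mul, Polynomial.eval_pow, Polynomial.eval_X,
      Polynomial.eval_C, hG u hu]
    rw [← mul_assoc, ← zpow_natCast, ← zpow_add₀ hu, show (N : ℤ) + _ = 0 by
      rw [← neg_eq_iff_add_eq_zero, neg_eq_iff_eq_neg]; exact hNeq.symm, zpow_zero, one_mul]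
  apply hFp
  have := congrArg (Polynomial.eval 0) hpoly
  simpa [hN0] using this.symm

/-! ### Normal forms of linear forms -/

theorem exists_eq_sum_smul_X {h : Form K n} (hh : h.IsHomogeneous 1) :
    ∃ a : Fin (n + 1) → K, h = ∑ i, a i • X i := by
  have : h ∈ Submodule.span K (Set.range (X : Fin (n + 1) → Form K n)) := by
    rw [← homogeneousSubmodule_one_eq_span_X]
    exact hh
  obtain ⟨a, ha⟩ := (Submodule.mem_span_range_iff_exists_fun K).1 this
  exact ⟨a, ha.symm⟩

theorem subst_sum_smul_X (A : Matrix (Fin (n + 1)) (Fin (n + 1)) K) (a : Fin (n + 1) → K) :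
    subst A (∑ i, a i • X i) = ∑ j, (Matrix.vecMul a A) j • X j := by
  have h (i : Fin (n + 1)) : subst A (a i • X i) = a i • ∑ j, C (A i j) * (X j : Form K n) := by
    rw [map_smul, subst, aeval_X]
  rw [map_sum]
  simp_rw [h]
  simp only [Finset.smul_sum, smul_eq_C_mul, Matrix.vecMul, dotProduct, map_sum, map_mul,
    Finset.sum_mul, mul_assoc]
  exact Finset.sum_comm

/-- `SL(n+1)` moves any two independent vectors to given coordinate vectors, up to a factor. -/
theorem exists_SL_vecMul_eq {a b : Fin (n + 1) → K} (hab : LinearIndependent K ![a, b])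
    {i j : Fin (n + 1)} (hij : i ≠ j) :
    ∃ (A : SL K n) (c : K), c ≠ 0 ∧ Matrix.vecMul a A.1 = Pi.single i c ∧
      Matrix.vecMul b A.1 = Pi.single j 1 := by
  have hli := hab.linearIndepOn_id
  let B := Module.Basis.extend hli
  have ha : a ∈ hli.extend (Set.subset_univ _) := hli.subset_extend _ ⟨0, rfl⟩
  have hb : b ∈ hli.extend (Set.subset_univ _) := hli.subset_extend _ ⟨1, rfl⟩
  have hne : a ≠ b := fun h => by
    have := hab.injective (a₁ := 0) (a₂ := 1) h
    simp at this
  have hfin : Fintype (hli.extend (Set.subset_univ _)) := FiniteDimensional.fintypeBasisIndex B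
  have hcard : Fintype.card (hli.extend (Set.subset_univ _)) = n + 1 := by
    rw [← Module.finrank_eq_card_basis B, Module.finrank_fin_fun]
  let e₀ := Fintype.equivFinOfCardEq hcard
  let e₁ := e₀.trans (Equiv.swap (e₀ ⟨a, ha⟩) i)
  have he₁ : e₁ ⟨a, ha⟩ = i := by simp [e₁]
  have hb₁ : e₁ ⟨b, hb⟩ ≠ i := by
    rw [← he₁]
    exact fun h => hne (congrArg Subtype.val (e₁.injective h)).symm
  let e := e₁.trans (Equiv.swap (e₁ ⟨b, hb⟩) j)
  have hea : e ⟨a, ha⟩ = i := by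
    simp [e, he₁, Equiv.swap_apply_of_ne_of_ne hb₁.symm hij]
  have heb : e ⟨b, hb⟩ = j := by simp [e]
  let N : Matrix (Fin (n + 1)) (Fin (n + 1)) K := Matrix.of fun p => (B.reindex e p)
  have hN : IsUnit N.det := by
    rw [← Matrix.isUnit_iff_isUnit_det, ← Matrix.linearIndependent_rows_iff_isUnit]
    exact (B.reindex e).linearIndependent
  have hNa : N i = a := by
    change B.reindex e i = a
    rw [← hea, B.reindex_apply, e.symm_apply_apply]
    simp [B]
  have hNb : N j = b := by
    change B.reindex e j = b
    rw [← heb, B.reindex_apply, e.symm_apply_apply]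
    simp [B]
  have hrow (p : Fin (n + 1)) : Matrix.vecMul (N p) N⁻¹ = Pi.single p 1 := by
    have : Matrix.vecMul (Pi.single p 1) N = N p := Matrix.single_one_vecMul p N
    rw [← this, Matrix.vecMul_vecMul, Matrix.mul_nonsing_inv _ hN,
      Matrix.vecMul_one]
  let D : Matrix (Fin (n + 1)) (Fin (n + 1)) K := Matrix.diagonal (Function.update 1 i N.det)
  refine ⟨⟨N⁻¹ * D, ?_⟩, N.det, hN.ne_zero, ?_, ?_⟩
  · rw [Matrix.det_mul, Matrix.det_diagonal, Finset.prod_update_of_mem (Finset.mem_univ i)]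
    simpa using inv_mul_cancel₀ hN.ne_zero
  · rw [← Matrix.vecMul_vecMul, ← hNa, hrow, Matrix.single_one_vecMul]
    ext q
    by_cases hq : q = i
    · subst hq; simp [D, Matrix.row]
    · simp [D, Matrix.row, hq, Ne.symm hq]
  · rw [← Matrix.vecMul_vecMul, ← hNb, hrow, Matrix.single_one_vecMul]
    ext q
    by_cases hq : q = j
    · subst hq; simp [D, Matrix.row, hij.symm]
    · simp [D, Matrix.row, hq, Ne.symm hq]

theorem sum_single_smul_X (i : Fin (n + 1)) (c : K) :
    ∑ j, (Pi.single i c : Fin (n + 1) → K) j • (X j : Form K n) = c • X i := by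
  rw [Finset.sum_eq_single i]
  · simp
  · intro j _ hj; simp [hj]
  · simp

/-- Two independent linear forms become coordinates, up to a factor, after a substitution in
`SL(n+1)`. -/
theorem exists_subst_eq_smul_X_pair {g h : Form K n} (hg : g.IsHomogeneous 1)
    (hh : h.IsHomogeneous 1) (hgh : LinearIndependent K ![g, h]) {i j : Fin (n + 1)} (hij : i ≠ j) :
    ∃ (A : SL K n) (c : K), c ≠ 0 ∧ subst A.1 g = c • X i ∧ subst A.1 h = X j := by
  obtain ⟨a, rfl⟩ := exists_eq_sum_smul_X hg
  obtain ⟨b, rfl⟩ := exists_eq_sum_smul_X hh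
  have hab : LinearIndependent K ![a, b] := by
    rw [LinearIndependent.pair_iff] at hgh ⊢
    intro s t hst
    apply hgh s t
    rw [Finset.smul_sum, Finset.smul_sum, ← Finset.sum_add_distrib]
    apply Finset.sum_eq_zero
    intro i _
    rw [smul_smul, smul_smul, ← add_smul]
    have := congrFun hst i
    simp only [Pi.add_apply, Pi.smul_apply, smul_eq_mul, Pi.zero_apply] at this
    rw [this, zero_smul]
  obtain ⟨A, c, hc, hA, hB⟩ := exists_SL_vecMul_eq hab hij
  refine ⟨A, c, hc, ?_, ?_⟩
  · rw [subst_sum_smul_X, hA, sum_single_smul_X]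
  · rw [subst_sum_smul_X, hB, sum_single_smul_X, one_smul]

theorem exists_subst_eq_smul_X (hn : 1 ≤ n) {g : Form K n} (hg : g.IsHomogeneous 1) (hg0 : g ≠ 0)
    (i : Fin (n + 1)) : ∃ (A : SL K n) (c : K), c ≠ 0 ∧ subst A.1 g = c • X i := by
  obtain ⟨a, rfl⟩ := exists_eq_sum_smul_X hg
  have ha : a ≠ 0 := by rintro rfl; simp at hg0
  obtain ⟨b, hab⟩ := exists_linearIndependent_pair_of_one_lt_finrank
    (by rw [Module.finrank_fin_fun]; omega) ha
  have : Nontrivial (Fin (n + 1)) := Fin.nontrivial_iff_two_le.2 (by omega)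
  obtain ⟨j, hij⟩ := exists_ne i
  obtain ⟨A, c, hc, hA, -⟩ := exists_SL_vecMul_eq hab hij.symm
  exact ⟨A, c, hc, by rw [subst_sum_smul_X, hA, sum_single_smul_X]⟩

/-! ### Destabilising subgroups -/

/-- The one-parameter subgroup contracting onto the linear subspace `x_j = ⋯ = x_n = 0` as `s → ∞`: its
weight is `n + 1 - j` on the first `j` coordinates and `-j` on the others. -/
def stepWeight (j : Fin (n + 1)) (i : Fin (n + 1)) : ℤ :=
  ((n + 1 : ℤ) - (j : ℕ)) - if j ≤ i then (n + 1 : ℤ) else 0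

theorem stepWeight_antitone (j : Fin (n + 1)) : Antitone (stepWeight j) := by
  intro a b hab
  unfold stepWeight
  split_ifs with h1 h2
  · exact le_rfl
  · linarith
  · exact absurd (le_trans ‹_› hab) h1
  · exact le_rfl

theorem sum_stepWeight (j : Fin (n + 1)) : ∑ i, stepWeight j i = 0 := by
  have hj := j.2
  have hc : (Finset.univ.filter fun i => j ≤ i).card = n + 1 - (j : ℕ) := by
    rw [← Fin.card_Ici j]
    congr 1
    ext i
    simp
  simp only [stepWeight, Finset.sum_sub_distrib, Finset.sum_const, Finset.card_univ,
    Fintype.card_fin, ← Finset.sum_filter, hc, nsmul_eq_mul]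
  rw [Nat.cast_sub hj.le]
  push_cast
  ring

theorem stepWeight_ne_zero {j : Fin (n + 1)} (hj : (j : ℕ) ≠ 0) : stepWeight j ≠ 0 := by
  intro h
  have h0 := congrFun h 0
  have : ¬ j ≤ 0 := by
    rw [Fin.le_def]
    simpa using hj
  simp only [stepWeight, this, if_false, Pi.zero_apply] at h0
  have := j.2
  omega

theorem sum_mul_stepWeight_le (j : Fin (n + 1)) {I : Fin (n + 1) →₀ ℕ} (hI : I.degree = d)
    (s : Finset (Fin (n + 1))) (hs : ∀ i ∈ s, j ≤ i) :
    ∑ i, (I i : ℤ) * stepWeight j i ≤ ((n + 1 : ℤ) - (j : ℕ)) * d - (n + 1) * ∑ i ∈ s, (I i : ℤ) := by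
  have h1 : ∑ i ∈ s, (I i : ℤ) ≤ ∑ i ∈ Finset.univ.filter (fun i => j ≤ i), (I i : ℤ) :=
    Finset.sum_le_sum_of_subset_of_nonneg (fun i hi => by simpa using hs i hi)
      fun i _ _ => Int.natCast_nonneg _
  have h2 : (d : ℤ) = ∑ i, (I i : ℤ) := by
    rw [← hI, Finsupp.degree_eq_sum]
    push_cast
    rfl
  have h3 : ∑ i, (I i : ℤ) * stepWeight j i = ((n + 1 : ℤ) - (j : ℕ)) * d
      - (n + 1) * ∑ i ∈ Finset.univ.filter (fun i => j ≤ i), (I i : ℤ) := by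
    rw [h2, Finset.mul_sum, Finset.mul_sum, Finset.sum_filter, ← Finset.sum_sub_distrib]
    apply Finset.sum_congr rfl
    intro i _
    unfold stepWeight
    split_ifs <;> ring
  rw [h3]
  have : (0 : ℤ) ≤ n + 1 := by positivity
  nlinarith

theorem degree_eq_of_coeff_ne_zero {f : Form K n} (hf : f.IsHomogeneous d) {I : Fin (n + 1) →₀ ℕ}
    (hI : coeff I f ≠ 0) : I.degree = d := by
  by_contra h
  exact hI (hf.coeff_eq_zero h)

theorem weightLE_stepWeight (j : Fin (n + 1)) {f : Form K n} (hf : f.IsHomogeneous d) :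
    WeightLE (stepWeight j) (((n + 1 : ℤ) - (j : ℕ)) * d) f := by
  intro I hI
  simpa using sum_mul_stepWeight_le j (degree_eq_of_coeff_ne_zero hf hI) ∅ (by simp)

theorem weightLE_stepWeight_of_mem (j : Fin (n + 1)) {f : Form K n} (hf : f.IsHomogeneous d)
    (hmem : f ∈ Ideal.span (X '' Set.Ici j : Set (Form K n))) :
    WeightLE (stepWeight j) (((n + 1 : ℤ) - (j : ℕ)) * d - (n + 1)) f := by
  intro I hI
  obtain ⟨i, hi, hIi⟩ := mem_ideal_span_X_image.1 hmem I (mem_support_iff.2 hI)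
  have h := sum_mul_stepWeight_le j (degree_eq_of_coeff_ne_zero hf hI) {i} (by simpa using hi)
  rw [Finset.sum_singleton] at h
  have h1 : (1 : ℤ) ≤ I i := by
    have := Nat.one_le_iff_ne_zero.2 hIi
    exact_mod_cast this
  have : (0 : ℤ) ≤ n + 1 := by positivity
  nlinarith

theorem Pair.HasNonnegBounds.act {t : ℚ} {p : Pair K n d k} (hp : p.HasNonnegBounds t) (A : SL K n) :
    (p.act A).HasNonnegBounds t := by
  intro B
  rw [Pair.act_mul]
  exact hp (A * B)

/-- The inequality given by the subgroup contracting onto `x_j = ⋯ = x_n = 0` when the members of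
the basis indexed by `s` vanish there. -/
theorem Pair.HasNonnegBounds.le_of_mem {t : ℚ} {p : Pair K n d k} (hp : p.HasNonnegBounds t)
    {j : Fin (n + 1)} (hj : (j : ℕ) ≠ 0) {f : Fin k → Form K n} (hf : p.S.IsFrame f)
    (s : Finset (Fin k)) (hs : ∀ i ∈ s, f i ∈ Ideal.span (X '' Set.Ici j : Set (Form K n)))
    {h : Form K n} (hh : Submodule.span K {h} = p.H.space) {v : ℤ}
    (hv : WeightLE (stepWeight j) v h) :
    0 ≤ ((n + 1 : ℚ) - (j : ℕ)) * (k * d) - (n + 1) * s.card + t * v := by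
  classical
  have hact := p.act_one
  have := hp 1 (stepWeight j) (stepWeight_antitone j) (sum_stepWeight j) (stepWeight_ne_zero hj) f h
    (fun i => ((n + 1 : ℤ) - (j : ℕ)) * d - if i ∈ s then (n + 1 : ℤ) else 0) v
    (hact.symm ▸ hf) (hact.symm ▸ hh) ?_ hv
  · simp only [Finset.sum_sub_distrib, Finset.sum_const, Finset.card_univ, Fintype.card_fin,
      ← Finset.sum_filter, Finset.filter_mem_eq_inter, Finset.univ_inter, nsmul_eq_mul] at this
    push_cast at this
    linarith
  · intro i
    by_cases hi : i ∈ s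
    · simpa only [hi, if_true] using weightLE_stepWeight_of_mem j (hf.isHomogeneous i) (hs i hi)
    · simpa only [hi, if_false, sub_zero] using weightLE_stepWeight j (hf.isHomogeneous i)

theorem Pair.HasNonnegBounds.le_of_dvd {t : ℚ} {p : Pair K n d k} (hp : p.HasNonnegBounds t)
    (hn : 1 ≤ n) {f : Fin k → Form K n} (hf : p.S.IsFrame f) {l : Form K n}
    (hl : l.IsHomogeneous 1) (hl0 : l ≠ 0) (s : Finset (Fin k)) (hs : ∀ i ∈ s, l ∣ f i) :
    0 ≤ (k * d : ℚ) - (n + 1) * s.card + t ∧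
      (l ∈ p.H.space → 0 ≤ (k * d : ℚ) - (n + 1) * s.card - t * n) := by
  obtain ⟨A, c, hc, hA⟩ := exists_subst_eq_smul_X hn hl hl0 (Fin.last n)
  have hlast : ((Fin.last n : Fin (n + 1)) : ℕ) ≠ 0 := by simp; omega
  have hmem (g : Form K n) (hg : l ∣ g) :
      subst A.1 g ∈ Ideal.span (X '' Set.Ici (Fin.last n) : Set (Form K n)) := by
    obtain ⟨q, rfl⟩ := hg
    rw [map_mul, hA]
    apply Ideal.mul_mem_right
    rw [smul_eq_C_mul]
    exact Ideal.mul_mem_left _ _ (Ideal.subset_span ⟨_, by simp, rfl⟩)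
  obtain ⟨h, hh⟩ := p.H.exists_span_eq
  have hhh : h.IsHomogeneous 1 := Gr.isHomogeneous (hh ▸ Submodule.mem_span_singleton_self h)
  constructor
  · have := (hp.act A).le_of_mem hlast (hf.act A) s (fun i hi => hmem _ (hs i hi))
      (Gr.span_act hh A) (weightLE_stepWeight _ (subst_isHomogeneous _ hhh))
    simp only [Fin.val_last] at this
    push_cast at this
    linarith
  · intro hlH
    have := (hp.act A).le_of_mem hlast (hf.act A) s (fun i hi => hmem _ (hs i hi))
      (Gr.span_act (Gr.span_eq_of_mem hlH hl0) A)
      (weightLE_stepWeight_of_mem _ (subst_isHomogeneous _ hl) (hmem l dvd_rfl))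
    simp only [Fin.val_last] at this
    push_cast at this
    linarith

/-- Destabilisation of a pair whose hyperplane contains a codimension two linear subspace of the
base locus. -/
theorem Pair.HasNonnegBounds.le_of_mem_span_pair {t : ℚ} {p : Pair K n d k}
    (hp : p.HasNonnegBounds t) (hk : k ≠ 0) (hn : 2 ≤ n) {g l : Form K n} (hg : g.IsHomogeneous 1)
    (hl : l ∈ p.H.space) (hgl : LinearIndependent K ![g, l])
    (hS : ∀ f ∈ p.S.space, f ∈ Ideal.span {g, l}) :
    0 ≤ (k : ℚ) * (2 * d - n - 1) - t * (n - 1) := by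
  have hl1 : l.IsHomogeneous 1 := Gr.isHomogeneous hl
  let j : Fin (n + 1) := ⟨n - 1, by omega⟩
  have hj : (j : ℕ) ≠ 0 := by simp only [j]; omega
  have hjl : j ≤ Fin.last n := Fin.le_last j
  have hne : j ≠ Fin.last n := by
    rw [ne_eq, Fin.ext_iff]
    simp only [j, Fin.val_last]
    omega
  obtain ⟨A, c, hc, hAg, hAl⟩ := exists_subst_eq_smul_X_pair hg hl1 hgl hne
  have hmem (f : Form K n) (hf : f ∈ Ideal.span {g, l}) :
      subst A.1 f ∈ Ideal.span (X '' Set.Ici j : Set (Form K n)) := by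
    obtain ⟨a, b, rfl⟩ := Ideal.mem_span_pair.1 hf
    rw [map_add, map_mul, map_mul, hAg, hAl, smul_eq_C_mul]
    exact Ideal.add_mem _
      (Ideal.mul_mem_left _ _ (Ideal.mul_mem_left _ _ (Ideal.subset_span ⟨_, by simp, rfl⟩)))
      (Ideal.mul_mem_left _ _ (Ideal.subset_span ⟨_, hjl, rfl⟩))
  obtain ⟨f, hf⟩ := p.S.exists_isFrame hk
  have := (hp.act A).le_of_mem hj (hf.act A) Finset.univ (fun i _ => hmem _ (hS _ (hf.mem i)))
    (Gr.span_act (Gr.span_eq_of_mem hl (hgl.ne_zero 1)) A)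
    (weightLE_stepWeight_of_mem _ (subst_isHomogeneous _ hl1)
      (hmem l (Ideal.subset_span (by simp))))
  have hjn : ((j : ℕ) : ℚ) = n - 1 := by
    simp only [j]
    rw [Nat.cast_sub (by omega)]
    simp
  have hjz : ((j : ℕ) : ℤ) = n - 1 := by
    simp only [j]
    rw [Nat.cast_sub (by omega)]
    simp
  rw [hjn, hjz] at this
  simp only [Finset.card_univ, Fintype.card_fin] at this
  push_cast at this
  linarith

/-- A pair is destabilised if its hyperplane is contained in a member of the linear system. -/
theorem Pair.HasNonnegBounds.noMemberContains {t : ℚ} {p : Pair K n d k} (hp : p.HasNonnegBounds t)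
    (hk : k ≠ 0) (hn : 1 ≤ n) (hkd : (k * d : ℚ) - (n + 1) - t * n < 0) :
    p.S.NoMemberContains p.H := by
  intro f hf hf0 l hl hl0 hlf
  obtain ⟨b, i, hb, rfl⟩ := p.S.exists_isFrame_apply_eq hk hf hf0
  have := (hp.le_of_dvd hn hb (Gr.isHomogeneous hl) hl0 {i} (by simpa using hlf)).2 hl
  simp only [Finset.card_singleton, Nat.cast_one, mul_one] at this
  linarith

theorem Pair.HasNonnegBounds.noMemberContains_of_lt {t : ℚ} {p : Pair K n d k}
    (hp : p.HasNonnegBounds t) (hk : k ≠ 0) (hn : 1 ≤ n) (hkd : (k * d : ℚ) - (n + 1) + t < 0)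
    (L : Gr K n 1 1) : p.S.NoMemberContains L := by
  intro f hf hf0 l hl hl0 hlf
  obtain ⟨b, i, hb, rfl⟩ := p.S.exists_isFrame_apply_eq hk hf hf0
  have := (hp.le_of_dvd hn hb (Gr.isHomogeneous hl) hl0 {i} (by simpa using hlf)).1
  simp only [Finset.card_singleton, Nat.cast_one, mul_one] at this
  linarith

theorem Gr.ideal_eq_span {H : Gr K n d 1} {h : Form K n} (hh : Submodule.span K {h} = H.space) :
    H.ideal = Ideal.span {h} := by
  apply le_antisymm
  · rw [Gr.ideal, Ideal.span_le]
    intro g hg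
    rw [← hh] at hg
    obtain ⟨c, rfl⟩ := Submodule.mem_span_singleton.1 hg
    rw [smul_eq_C_mul]
    exact Ideal.mul_mem_left _ _ (Ideal.mem_span_singleton_self h)
  · rw [Ideal.span_singleton_le_iff_mem]
    apply Ideal.subset_span
    rw [← hh]
    exact Submodule.mem_span_singleton_self h

theorem Pair.HasNonnegBounds.not_ideal_le {t : ℚ} {p : Pair K n d k}
    (hp : p.HasNonnegBounds t) (hk : k ≠ 0) (hn : 1 ≤ n) (hkd : (k * d : ℚ) - (n + 1) * k + t < 0)
    (L : Gr K n 1 1) : ¬ p.S.ideal ≤ L.ideal := by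
  intro hle
  obtain ⟨l, hl⟩ := L.exists_span_eq
  obtain ⟨b, hb⟩ := p.S.exists_isFrame hk
  have := (hp.le_of_dvd hn hb
    (Gr.isHomogeneous (hl ▸ Submodule.mem_span_singleton_self l)) (Gr.ne_zero_of_span_eq hl)
    Finset.univ fun i _ => by
      rw [← Ideal.mem_span_singleton, ← Gr.ideal_eq_span hl]
      exact hle (Ideal.subset_span (hb.mem i))).1
  simp only [Finset.card_univ, Fintype.card_fin] at this
  linarith

/-! ### Heights and components in a hyperplane -/

theorem coeff_eq_zero_of_mem_ideal {Φ : Gr K n d k} {f : Form K n} (hf : f ∈ Φ.ideal)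
    {I : Fin (n + 1) →₀ ℕ} (hI : I.degree < d) : coeff I f = 0 := by
  have hle : Φ.ideal ≤ idealOfVars (Fin (n + 1)) K ^ d := by
    rw [Gr.ideal, Ideal.span_le]
    intro g hg
    rw [SetLike.mem_coe, mem_pow_idealOfVars_iff']
    intro J hJ
    exact (Gr.isHomogeneous hg).coeff_eq_zero hJ.ne
  exact (mem_pow_idealOfVars_iff' d f).1 (hle hf) I hI

theorem Gr.IsFrame.ideal_eq {Φ : Gr K n d k} {f : Fin k → Form K n} (hf : Φ.IsFrame f) :
    Φ.ideal = Ideal.span (Set.range f) := by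
  apply le_antisymm
  · rw [Gr.ideal, Ideal.span_le]
    intro g hg
    rw [← hf] at hg
    exact Submodule.span_subset_span K (Form K n) _ hg
  · exact Ideal.span_mono fun g ⟨i, hi⟩ => hi ▸ hf.mem i

theorem Pair.idealD_ne_top (hd : 1 ≤ d) (p : Pair K n d k) : p.idealD ≠ ⊤ := by
  intro h
  have h0 (f : Form K n) (hf : f ∈ p.idealD) : coeff 0 f = 0 := by
    obtain ⟨a, ha, b, hb, rfl⟩ := Submodule.mem_sup.1 hf
    rw [coeff_add, coeff_eq_zero_of_mem_ideal ha (by rw [map_zero]; omega),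
      coeff_eq_zero_of_mem_ideal hb (by simp), add_zero]
  simpa using h0 1 (h ▸ Submodule.mem_top)

/-- A hyperplane containing no component of a complete intersection cuts it in a complete
intersection, by Krull's height theorem. -/
theorem Pair.isDivisorCompleteIntersection_of_not_le (hk : k ≠ 0) (hd : 1 ≤ d) {p : Pair K n d k}
    (hS : p.S.IsCompleteIntersection) (hP : ∀ P ∈ p.S.ideal.minimalPrimes, ¬ p.H.ideal ≤ P) :
    p.IsDivisorCompleteIntersection := by
  refine ⟨hP, le_antisymm ?_ ?_⟩
  · obtain ⟨f, hf⟩ := p.S.exists_isFrame hk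
    obtain ⟨h, hh⟩ := p.H.exists_span_eq
    have hD : p.idealD = Ideal.span (insert h (Set.range f)) := by
      rw [Pair.idealD, hf.ideal_eq, Gr.ideal_eq_span hh, Ideal.span_insert, sup_comm]
    obtain ⟨Q, hQ⟩ := Ideal.nonempty_minimalPrimes (p.idealD_ne_top hd)
    have hQle := Ideal.height_mono hQ.1.2
    have hfin : (insert h (Set.range f)).Finite := (Set.finite_range f).insert h
    rw [hD] at hQ
    have hcard : (insert h (Set.range f)).ncard ≤ k + 1 := by
      refine (Set.ncard_insert_le _ _).trans (Nat.succ_le_succ ?_)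
      rw [← Set.image_univ]
      refine (Set.ncard_image_le Set.finite_univ).trans ?_
      simp
    exact hQle.trans ((Ideal.height_le_card_of_mem_minimalPrimes_span hfin hQ).trans
      (by exact_mod_cast hcard))
  · rw [Ideal.height_eq_inf_minimalPrimes]
    refine le_iInf₂ fun Q hQ => ?_
    have hQp : Q.IsPrime := hQ.1.1
    have hSQ : p.S.ideal ≤ Q := le_sup_left.trans hQ.1.2
    obtain ⟨P, hPm, hPQ⟩ := Ideal.exists_minimalPrimes_le hSQ
    have hPp : P.IsPrime := hPm.1.1
    have hlt : P < Q := lt_of_le_of_ne hPQ fun h =>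
      hP P hPm (h ▸ le_sup_right.trans hQ.1.2)
    have h1 : (k : ℕ∞) ≤ P.height := by
      rw [← show p.S.ideal.height = k from hS]
      exact Ideal.height_mono hPm.1.2
    calc ((k + 1 : ℕ) : ℕ∞) = k + 1 := by push_cast; rfl
      _ ≤ P.height + 1 := by gcongr
      _ ≤ Q.height := Ideal.height_add_one_le_of_lt_of_isPrime hlt

/-- An integral `S` lies in no hyperplane, since its equations have degree at least two. -/
theorem Gr.IsVariety.not_ideal_le (hd : 1 < d) {S : Gr K n d k} (hS : S.IsVariety) (H : Gr K n 1 1) :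
    ∀ P ∈ S.ideal.minimalPrimes, ¬ H.ideal ≤ P := by
  intro P hP hle
  have hSP : S.IsVariety := hS
  rw [Gr.IsVariety] at hSP
  have hPS : P ≤ S.ideal := hP.2 ⟨hS, le_rfl⟩ hP.1.2
  obtain ⟨h, hh⟩ := H.exists_span_eq
  have hmem : h ∈ H.space := hh ▸ Submodule.mem_span_singleton_self h
  apply Gr.ne_zero_of_span_eq hh
  ext I
  by_cases hI : I.degree = 1
  · exact coeff_eq_zero_of_mem_ideal (hPS (hle (Ideal.subset_span hmem))) (by rw [hI]; exact hd)
  · exact (Gr.isHomogeneous hmem).coeff_eq_zero hI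

theorem isUnit_of_totalDegree_eq_zero {σ : Type*} {u : MvPolynomial σ K} (hu : u ≠ 0)
    (h : u.totalDegree = 0) : IsUnit u := by
  rw [totalDegree_eq_zero_iff_eq_C] at h
  rw [h] at hu ⊢
  exact (isUnit_iff_ne_zero.2 fun h0 => hu (by rw [h0, map_zero])).map C

theorem dvd_of_dvd_of_isHomogeneous_one {σ : Type*} {q h : MvPolynomial σ K}
    (hh : h.IsHomogeneous 1) (h0 : h ≠ 0) (hq : ¬ IsUnit q) (hqh : q ∣ h) : h ∣ q := by
  obtain ⟨u, rfl⟩ := hqh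
  have hq0 := left_ne_zero_of_mul h0
  have hu0 := right_ne_zero_of_mul h0
  have hdeg := hh.totalDegree h0
  rw [totalDegree_mul_of_isDomain hq0 hu0] at hdeg
  have hq1 : q.totalDegree ≠ 0 := fun h => hq (isUnit_of_totalDegree_eq_zero hq0 h)
  exact (isUnit_of_totalDegree_eq_zero hu0 (by omega)).mul_right_dvd.2 dvd_rfl

theorem exists_prime_dvd_mem {R : Type*} [CommRing R] [IsDomain R] [UniqueFactorizationMonoid R]
    {P : Ideal R} [hP : P.IsPrime] {f : R} (hf : f ∈ P) (hf0 : f ≠ 0) :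
    ∃ q ∈ P, Prime q ∧ q ∣ f := by
  obtain ⟨s, hs, hsf⟩ := UniqueFactorizationMonoid.exists_prime_factors f hf0
  have hmem : s.prod ∈ P := by
    obtain ⟨u, hu⟩ := hsf.symm
    rw [← hu]
    exact P.mul_mem_right _ hf
  obtain ⟨q, hq, hqP⟩ := (hP.multiset_prod_mem_iff_exists_mem s).1 hmem
  exact ⟨q, hqP, hs q hq, (Multiset.dvd_prod hq).trans hsf.dvd⟩

theorem not_ideal_le_of_eq_one {S : Gr K n d 1} {H : Gr K n 1 1} (hSH : S.NoMemberContains H) :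
    ∀ P ∈ S.ideal.minimalPrimes, ¬ H.ideal ≤ P := by
  intro P hP hle
  have hPp : P.IsPrime := hP.1.1
  obtain ⟨f, hf⟩ := S.exists_span_eq
  obtain ⟨h, hh⟩ := H.exists_span_eq
  have hmem : h ∈ H.space := hh ▸ Submodule.mem_span_singleton_self h
  have hfS : f ∈ S.space := hf ▸ Submodule.mem_span_singleton_self f
  have hh0 := Gr.ne_zero_of_span_eq hh
  obtain ⟨q, hqP, hq, hqf⟩ := exists_prime_dvd_mem (hP.1.2 (Ideal.subset_span hfS))
    (Gr.ne_zero_of_span_eq hf)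
  have hqprime : (Ideal.span {q}).IsPrime := (Ideal.span_singleton_prime hq.ne_zero).2 hq
  have hPq : P ≤ Ideal.span {q} := by
    apply hP.2 ⟨hqprime, _⟩ ((Ideal.span_singleton_le_iff_mem _).2 hqP)
    rw [Gr.ideal_eq_span hf, Ideal.span_singleton_le_span_singleton]
    exact hqf
  have hqh : q ∣ h := Ideal.mem_span_singleton.1 (hPq (hle (Ideal.subset_span hmem)))
  exact hSH f hfS (Gr.ne_zero_of_span_eq hf) h hmem hh0
    ((dvd_of_dvd_of_isHomogeneous_one (Gr.isHomogeneous hmem) hh0 hq.not_isUnit hqh).trans hqf)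

/-- Restriction of forms to a hyperplane `{h = 0}`, with a section. -/
theorem exists_restriction (hn : 1 ≤ n) {h : Form K n} (hh : h.IsHomogeneous 1) (h0 : h ≠ 0) :
    ∃ (π : Form K n →ₐ[K] MvPolynomial (Fin n) K) (σ : MvPolynomial (Fin n) K →ₐ[K] Form K n),
      (∀ f, π (σ f) = f) ∧ (∀ f, π f = 0 ↔ h ∣ f) ∧
      (∀ f (m : ℕ), f.IsHomogeneous m → (π f).IsHomogeneous m) ∧
      ∀ f (m : ℕ), f.IsHomogeneous m → (σ f).IsHomogeneous m := by
  obtain ⟨A, c, hc, hA⟩ := exists_subst_eq_smul_X hn hh h0 (Fin.last n)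
  let π₀ : Form K n →ₐ[K] MvPolynomial (Fin n) K :=
    aeval (Fin.lastCases 0 X : Fin (n + 1) → MvPolynomial (Fin n) K)
  let σ₀ : MvPolynomial (Fin n) K →ₐ[K] Form K n := rename Fin.castSucc
  have hπσ (f) : π₀ (σ₀ f) = f := by
    have : π₀.comp σ₀ = AlgHom.id K _ := by
      ext1 i
      simp [π₀, σ₀]
    exact DFunLike.congr_fun this f
  have hσπ (f) : (X (Fin.last n) : Form K n) ∣ f - σ₀ (π₀ f) := by
    rw [← Ideal.mem_span_singleton, ← Ideal.Quotient.mk_eq_mk_iff_sub_mem]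
    have : (Ideal.Quotient.mkₐ K (Ideal.span {(X (Fin.last n) : Form K n)})) =
        ((Ideal.Quotient.mkₐ K (Ideal.span {(X (Fin.last n) : Form K n)})).comp σ₀).comp π₀ := by
      ext1 i
      refine Fin.lastCases ?_ (fun i => ?_) i
      · simp [π₀]
      · simp [π₀, σ₀]
    exact DFunLike.congr_fun this f
  have hAinv (f : Form K n) : subst A.1 (subst (A⁻¹).1 f) = f := by
    rw [subst_subst, ← Matrix.SpecialLinearGroup.coe_mul, inv_mul_cancel,
      Matrix.SpecialLinearGroup.coe_one, subst_one]
  have hAinv' (f : Form K n) : subst (A⁻¹).1 (subst A.1 f) = f := by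
    rw [subst_subst, ← Matrix.SpecialLinearGroup.coe_mul, mul_inv_cancel,
      Matrix.SpecialLinearGroup.coe_one, subst_one]
  have hX : (X (Fin.last n) : Form K n) = C c⁻¹ * subst A.1 h := by
    rw [hA, smul_eq_C_mul, ← mul_assoc, ← C_mul, inv_mul_cancel₀ hc, C_1, one_mul]
  refine ⟨π₀.comp (subst A.1), (subst (A⁻¹).1).comp σ₀, ?_, ?_, ?_, ?_⟩
  · intro f
    simp only [AlgHom.comp_apply, hAinv, hπσ]
  · intro f
    simp only [AlgHom.comp_apply]
    constructor
    · intro hf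
      have h1 := hσπ (subst A.1 f)
      rw [hf, map_zero, sub_zero] at h1
      have h2 := map_dvd (subst (A⁻¹).1) ((Dvd.intro_left _ hX.symm).trans h1)
      rwa [hAinv', hAinv'] at h2
    · rintro ⟨q, rfl⟩
      rw [map_mul, map_mul, hA, map_smul]
      simp [π₀]
  · intro f m hf
    have := (subst_isHomogeneous A.1 hf).aeval (n := 1)
      (Fin.lastCases 0 X : Fin (n + 1) → MvPolynomial (Fin n) K) fun i => by
        refine Fin.lastCases ?_ (fun i => ?_) i
        · simpa using isHomogeneous_zero _ _ _
        · simpa using isHomogeneous_X _ _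
    simpa [π₀] using this
  · intro f m hf
    exact subst_isHomogeneous _ hf.rename_isHomogeneous

theorem height_map_le_one {R R' : Type*} [CommRing R] [IsDomain R] [CommRing R'] [IsDomain R']
    (π : R →+* R') (hπ : Function.Surjective π) (hker : RingHom.ker π ≠ ⊥) {P : Ideal R}
    [P.IsPrime] (hP : RingHom.ker π ≤ P) (hht : P.height ≤ 2) [(P.map π).IsPrime] :
    (P.map π).height ≤ 1 := by
  rw [← Nat.cast_one, Ideal.height_le_iff]
  intro q hq hqP
  rw [Nat.cast_one, Order.lt_one_iff, Ideal.height_eq_zero_iff_eq_bot]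
  by_contra hq0
  have hPc : (P.map π).comap π = P := by
    rw [Ideal.comap_map_of_surjective' π hπ, sup_eq_left]
    exact hP
  have hlt {I J : Ideal R'} (hIJ : I < J) : I.comap π < J.comap π :=
    lt_iff_le_not_ge.2 ⟨Ideal.comap_mono hIJ.le, fun h =>
      hIJ.not_ge ((Ideal.comap_le_comap_iff_of_surjective π hπ _ _).1 h)⟩
  have h1 : RingHom.ker π < q.comap π := by
    rw [RingHom.ker_eq_comap_bot]
    exact hlt (bot_lt_iff_ne_bot.2 hq0)
  have h2 : q.comap π < P := by
    conv_rhs => rw [← hPc]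
    exact hlt hqP
  have hkp : (RingHom.ker π).IsPrime := RingHom.ker_isPrime π
  have h3 := Ideal.height_add_one_le_of_lt_of_isPrime h1
  have h4 := Ideal.height_add_one_le_of_lt_of_isPrime h2
  have h5 := Ideal.height_add_one_le_of_lt_of_isPrime (bot_lt_iff_ne_bot.2 hker)
  have h6 : (3 : ℕ∞) ≤ P.height := by
    calc (3 : ℕ∞) = 0 + 1 + 1 + 1 := by norm_num
      _ ≤ P.height := by
        refine le_trans ?_ h4
        gcongr
        refine le_trans ?_ h3
        gcongr
        refine le_trans ?_ h5
        gcongr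
        exact zero_le
  exact absurd (h6.trans hht) (by decide)

/-! ### Pencils of quadrics -/

/-- A factorisation of a quadratic form into polynomials of degree one may be replaced by the
factorisation into their linear parts. -/
theorem eq_mul_homogeneousComponent_one {σ : Type*} {F q l : MvPolynomial σ K}
    (hF : F.IsHomogeneous 2) (hq : q.totalDegree ≤ 1) (hl : l.totalDegree ≤ 1) (h : F = q * l) :
    F = homogeneousComponent 1 q * homogeneousComponent 1 l := by
  have hdec {p : MvPolynomial σ K} (hp : p.totalDegree ≤ 1) :
      p = C (coeff 0 p) + homogeneousComponent 1 p := by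
    have h1 := sum_homogeneousComponent p
    have h2 : ∑ i ∈ Finset.range 2, homogeneousComponent i p = p := by
      conv_rhs => rw [← h1]
      symm
      apply Finset.sum_subset
      · intro i hi
        rw [Finset.mem_range] at hi ⊢
        omega
      · intro i _ hi
        apply homogeneousComponent_eq_zero
        rw [Finset.mem_range] at hi
        omega
    rw [Finset.sum_range_succ, Finset.sum_range_one, homogeneousComponent_zero] at h2
    exact h2.symm
  set q₁ := homogeneousComponent 1 q with hq₁
  set l₁ := homogeneousComponent 1 l with hl₁
  have hq₁h : q₁.IsHomogeneous 1 := homogeneousComponent_isHomogeneous 1 q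
  have hl₁h : l₁.IsHomogeneous 1 := homogeneousComponent_isHomogeneous 1 l
  have hsub : (F - q₁ * l₁).IsHomogeneous 2 := hF.sub (hq₁h.mul hl₁h)
  by_contra hne
  have hdeg := hsub.totalDegree (sub_ne_zero.2 hne)
  have heq : F - q₁ * l₁ = C (coeff 0 q) * l + C (coeff 0 l) * q₁ := by
    rw [h]
    calc q * l - q₁ * l₁ = (C (coeff 0 q) + q₁) * l - q₁ * l₁ := by rw [← hdec hq]
      _ = C (coeff 0 q) * l + q₁ * (l - l₁) := by ring
      _ = _ := by
        have : l - l₁ = C (coeff 0 l) := sub_eq_iff_eq_add.2 (hdec hl)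
        rw [this]
        ring
  have hle : (F - q₁ * l₁).totalDegree ≤ 1 := by
    rw [heq]
    refine (totalDegree_add _ _).trans (max_le ?_ ?_)
    · refine (totalDegree_mul _ _).trans ?_
      rw [totalDegree_C, zero_add]
      exact hl
    · refine (totalDegree_mul _ _).trans ?_
      rw [totalDegree_C, zero_add]
      exact hq₁h.totalDegree_le
  omega

/-- If a component of the intersection of two quadrics lies in a hyperplane contained in no quadric
of the pencil, then the quadrics restricted to the hyperplane have a common linear factor, so that
the component is a codimension two linear subspace. -/
theorem exists_linear_of_mem_minimalPrimes {S : Gr K n 2 2} {H : Gr K n 1 1} (hn : 1 ≤ n)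
    (hSH : S.NoMemberContains H) {P : Ideal (Form K n)} (hP : P ∈ S.ideal.minimalPrimes)
    (hHP : H.ideal ≤ P) {h : Form K n} (hh : Submodule.span K {h} = H.space) :
    ∃ g : Form K n, g.IsHomogeneous 1 ∧ LinearIndependent K ![g, h] ∧
      ∀ f ∈ S.space, f ∈ Ideal.span {g, h} := by
  have hPp : P.IsPrime := hP.1.1
  have hmem : h ∈ H.space := hh ▸ Submodule.mem_span_singleton_self h
  have h0 : h ≠ 0 := Gr.ne_zero_of_span_eq hh
  obtain ⟨π, σ, hπσ, hker, hπ, hσ⟩ := exists_restriction hn (Gr.isHomogeneous hmem) h0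
  obtain ⟨b, hb⟩ := S.exists_isFrame two_ne_zero
  have hht : P.height ≤ 2 := by
    rw [hb.ideal_eq] at hP
    refine (Ideal.height_le_card_of_mem_minimalPrimes_span (Set.finite_range b) hP).trans ?_
    have : (Set.range b).ncard ≤ 2 := by
      rw [← Set.image_univ]
      refine (Set.ncard_image_le Set.finite_univ).trans ?_
      simp
    exact_mod_cast this
  have hsurj : Function.Surjective (π : Form K n →+* MvPolynomial (Fin n) K) :=
    fun f => ⟨σ f, hπσ f⟩
  have hkerP : RingHom.ker (π : Form K n →+* MvPolynomial (Fin n) K) ≤ P := by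
    intro f hf
    obtain ⟨u, rfl⟩ := (hker f).1 hf
    exact P.mul_mem_right _ (hHP (Ideal.subset_span hmem))
  have hker0 : RingHom.ker (π : Form K n →+* MvPolynomial (Fin n) K) ≠ ⊥ := by
    intro hbot
    have : h ∈ RingHom.ker (π : Form K n →+* MvPolynomial (Fin n) K) := (hker h).2 dvd_rfl
    rw [hbot] at this
    exact h0 this
  have hP'p := Ideal.map_isPrime_of_surjective hsurj hkerP
  have hht' := height_map_le_one _ hsurj hker0 hkerP hht
  set P' := P.map (π : Form K n →+* MvPolynomial (Fin n) K)
  have hπP (f : Form K n) (hf : f ∈ S.space) : π f ∈ P' :=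
    Ideal.mem_map_of_mem _ (hP.1.2 (Ideal.subset_span hf))
  have hπ0 (f : Form K n) (hf : f ∈ S.space) (hf0 : f ≠ 0) : π f ≠ 0 := fun h' =>
    hSH f hf hf0 h hmem h0 ((hker f).1 h')
  have hb0 (i : Fin 2) : π (b i) ≠ 0 := hπ0 _ (hb.mem i) (hb.linearIndependent.ne_zero i)
  have hP'0 : P'.height ≠ 0 := by
    rw [ne_eq, Ideal.height_eq_zero_iff_eq_bot]
    intro hbot
    have := hπP _ (hb.mem 0)
    rw [hbot] at this
    exact hb0 0 this
  have hP'1 : P'.height = 1 := le_antisymm hht' (Order.one_le_iff_ne_zero.2 hP'0)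
  obtain ⟨q, hqP, hq, -⟩ := exists_prime_dvd_mem (hπP _ (hb.mem 0)) (hb0 0)
  have hP'q := Ideal.eq_span_singleton_of_height_eq_one hP'1 hqP hq
  have hfac (f : Form K n) (hf : f ∈ S.space) : ∃ l, π f = q * l := by
    have := hπP f hf
    rw [hP'q, Ideal.mem_span_singleton] at this
    exact this
  have hdeg (f : Form K n) (hf : f ∈ S.space) (hf0 : f ≠ 0) {l} (hl : π f = q * l) :
      q.totalDegree + l.totalDegree = 2 := by
    have h1 := hπ0 f hf hf0
    have h2 := (hπ f 2 (Gr.isHomogeneous hf)).totalDegree h1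
    rw [hl] at h1 h2
    rwa [totalDegree_mul_of_isDomain (left_ne_zero_of_mul h1) (right_ne_zero_of_mul h1)] at h2
  have hq1 : q.totalDegree ≠ 0 := fun h' =>
    hq.not_isUnit (isUnit_of_totalDegree_eq_zero hq.ne_zero h')
  -- If `q` had degree two, the two quadrics would be proportional on the hyperplane.
  have hq2 : q.totalDegree ≠ 2 := by
    intro h2
    obtain ⟨l₀, hl₀⟩ := hfac _ (hb.mem 0)
    obtain ⟨l₁, hl₁⟩ := hfac _ (hb.mem 1)
    have hd₀ := hdeg _ (hb.mem 0) (hb.linearIndependent.ne_zero 0) hl₀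
    have hd₁ := hdeg _ (hb.mem 1) (hb.linearIndependent.ne_zero 1) hl₁
    have hc₀ := totalDegree_eq_zero_iff_eq_C.1 (show l₀.totalDegree = 0 by omega)
    have hc₁ := totalDegree_eq_zero_iff_eq_C.1 (show l₁.totalDegree = 0 by omega)
    set a₀ := coeff 0 l₀
    set a₁ := coeff 0 l₁
    have hz : π (a₁ • b 0 - a₀ • b 1) = 0 := by
      rw [map_sub, map_smul, map_smul, hl₀, hl₁, hc₀, hc₁, smul_eq_C_mul, smul_eq_C_mul]
      ring
    have hcomb : a₁ • b 0 - a₀ • b 1 = 0 := by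
      by_contra hne
      exact hπ0 _ (S.space.sub_mem (S.space.smul_mem _ (hb.mem 0))
        (S.space.smul_mem _ (hb.mem 1))) hne hz
    have hlin := Fintype.linearIndependent_iff.1 hb.linearIndependent ![a₁, -a₀]
      (by simpa [Fin.sum_univ_two, sub_eq_add_neg] using hcomb) 0
    have ha₁ : a₁ = 0 := hlin
    apply hb0 1
    rw [hl₁, hc₁, ha₁, map_zero, mul_zero]
  set g' := homogeneousComponent 1 q with hg'
  have hg'h : g'.IsHomogeneous 1 := homogeneousComponent_isHomogeneous 1 q
  have hfac' (f : Form K n) (hf : f ∈ S.space) (hf0 : f ≠ 0) : ∃ l, π f = g' * l := by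
    obtain ⟨l, hl⟩ := hfac f hf
    have := hdeg f hf hf0 hl
    exact ⟨_, eq_mul_homogeneousComponent_one (hπ f 2 (Gr.isHomogeneous hf)) (by omega) (by omega)
      hl⟩
  have hg'0 : g' ≠ 0 := by
    intro hg0
    obtain ⟨l, hl⟩ := hfac' _ (hb.mem 0) (hb.linearIndependent.ne_zero 0)
    apply hb0 0
    rw [hl, hg0, zero_mul]
  refine ⟨σ g', hσ _ _ hg'h, ?_, ?_⟩
  · rw [LinearIndependent.pair_iff]
    intro s t hst
    have hs : s = 0 := by
      have := congrArg π hst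
      rw [map_add, map_smul, map_smul, hπσ, (hker h).2 dvd_rfl, smul_zero, add_zero, map_zero,
        smul_eq_zero] at this
      exact this.resolve_right hg'0
    refine ⟨hs, ?_⟩
    rw [hs, zero_smul, zero_add, smul_eq_zero] at hst
    exact hst.resolve_right h0
  · intro f hf
    by_cases hf0 : f = 0
    · rw [hf0]
      exact Ideal.zero_mem _
    obtain ⟨l, hl⟩ := hfac' f hf hf0
    have hz : π (f - σ g' * σ l) = 0 := by rw [map_sub, map_mul, hπσ, hπσ, hl, sub_self]
    obtain ⟨u, hu⟩ := (hker _).1 hz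
    rw [Ideal.mem_span_pair]
    refine ⟨σ l, u, ?_⟩
    rw [sub_eq_iff_eq_add] at hu
    rw [hu]
    ring

/-- The complete intersection statement for `D`, in all three cases and in the whole range of `t`.
For `k = d = 2` the strictness in `ht'` is what excludes `n = 3`, `t = 0`. -/
theorem Pair.HasNonnegBounds.isDivisorCompleteIntersection {t : ℚ} {p : Pair K n d k}
    (hp : p.HasNonnegBounds t) (hk : 1 ≤ k) (hd : 1 < d) (ht : 0 ≤ t) (hkd : k * d ≤ n + 1)
    (ht' : 0 < t ∨ k * d ≤ n) (hpH : p.S.NoMemberContains p.H) (hS : p.S.IsCompleteIntersection)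
    (hcase : p.S.IsVariety ∨ k = 1 ∨ (k = 2 ∧ d = 2)) : p.IsDivisorCompleteIntersection := by
  apply Pair.isDivisorCompleteIntersection_of_not_le (by omega) hd.le hS
  rcases hcase with hV | rfl | ⟨rfl, rfl⟩
  · exact hV.not_ideal_le hd p.H
  · exact not_ideal_le_of_eq_one hpH
  · intro P hP hle
    obtain ⟨h, hh⟩ := p.H.exists_span_eq
    obtain ⟨g, hg, hgh, hSg⟩ := exists_linear_of_mem_minimalPrimes (by omega) hpH hP hle hh
    have := hp.le_of_mem_span_pair two_ne_zero (by omega) hg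
      (hh ▸ Submodule.mem_span_singleton_self h) hgh hSg
    push_cast at this
    have hn3 : (3 : ℚ) ≤ n := by
      have : 3 ≤ n := by omega
      exact_mod_cast this
    rcases ht' with ht' | ht'
    · nlinarith
    · have hn4 : (4 : ℚ) ≤ n := by exact_mod_cast ht'
      nlinarith

/-! ### Images of polynomial maps -/

/-- Chevalley's theorem for the image `O` of a principal open subset of affine space under a
polynomial map: `O` contains a nonempty principal open subset of its closure. -/
theorem exists_eval_ne_zero_imp_mem_image {K σ τ : Type*} [Field K] [IsAlgClosed K] [Finite σ]
    [Finite τ] (φ : σ → MvPolynomial τ K) {δ : MvPolynomial τ K} (hδ : δ ≠ 0) {O : Set (σ → K)}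
    (hO : O = {x | ∃ y : τ → K, eval y δ ≠ 0 ∧ x = fun i => eval y (φ i)}) :
    ∃ g ∉ vanishingIdeal K O, ∀ x ∈ zeroLocus K (vanishingIdeal K O), eval x g ≠ 0 → x ∈ O := by
  have hcomp (y : τ → K) (F : MvPolynomial σ K) :
      eval y (aeval φ F) = eval (fun i => eval y (φ i)) F := by
    have : (aeval (R := K) y).comp (aeval φ) = aeval (R := K) fun i => eval y (φ i) := by
      ext1 i
      simp [aeval_eq_eval]
    simpa [aeval_eq_eval] using DFunLike.congr_fun this F
  let f : MvPolynomial σ K →+* MvPolynomial τ K := (aeval φ : MvPolynomial σ K →ₐ[K] _)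
  have hf : f.FinitePresentation := by
    rw [← RingHom.FinitePresentation.of_finiteType]
    apply RingHom.FiniteType.of_comp_finiteType (f := (C : K →+* MvPolynomial σ K))
    have : f.comp C = algebraMap K (MvPolynomial τ K) := by
      ext1 a
      simp [f, algebraMap_eq]
    rw [this]
    exact RingHom.finiteType_algebraMap.2 inferInstance
  obtain ⟨S, hS⟩ := PrimeSpectrum.exists_constructibleSetData_iff.2
    (PrimeSpectrum.isConstructible_comap_image hf
      (PrimeSpectrum.isConstructible_basicOpen (f := δ)))
  have hgen : PrimeSpectrum.comap f ⊥ ∈ S.toSet := by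
    rw [hS]
    exact ⟨_, by simpa using hδ, rfl⟩
  simp only [PrimeSpectrum.ConstructibleSetData.toSet, Set.mem_iUnion] at hgen
  obtain ⟨c, hcS, hc⟩ := hgen
  have hcg (i : Fin c.n) : f (c.g i) = 0 := by
    simpa using hc.1 ⟨i, rfl⟩
  have hcf : f c.f ≠ 0 := by
    simpa [PrimeSpectrum.BasicConstructibleSetData.toSet] using hc.2
  refine ⟨c.f, fun hmem => ?_, fun x hx hgx => ?_⟩
  · apply mul_ne_zero hcf hδ
    apply MvPolynomial.funext
    intro y
    rw [map_mul, map_zero]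
    by_cases hy : eval y δ = 0
    · rw [hy, mul_zero]
    · have := hmem (fun i => eval y (φ i)) (hO ▸ ⟨y, hy, rfl⟩)
      rw [aeval_eq_eval] at this
      change eval y (aeval φ c.f) * _ = 0
      rw [hcomp, show eval (fun i => eval y (φ i)) c.f = 0 from this, zero_mul]
  · have hxS : (pointToPoint x : PrimeSpectrum (MvPolynomial σ K)) ∈ S.toSet := by
      simp only [PrimeSpectrum.ConstructibleSetData.toSet, Set.mem_iUnion]
      refine ⟨c, hcS, ?_, ?_⟩
      · rintro _ ⟨i, rfl⟩
        refine (mem_vanishingIdeal_singleton_iff x _).2 (hx _ ?_)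
        rw [mem_vanishingIdeal_iff, hO]
        rintro _ ⟨y, -, rfl⟩
        rw [aeval_eq_eval]
        have := congrArg (eval y) (hcg i)
        rw [map_zero] at this
        exact (hcomp y _).symm.trans this
      · intro h
        apply hgx
        have := (mem_vanishingIdeal_singleton_iff x _).1 (h rfl)
        rwa [aeval_eq_eval] at this
    rw [hS] at hxS
    obtain ⟨Q, hQδ, hQ⟩ := hxS
    have hδQ : δ ∉ vanishingIdeal K (zeroLocus K Q.asIdeal) := by
      rw [vanishingIdeal_zeroLocus_eq_radical, Q.isPrime.radical]
      exact hQδ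
    rw [mem_vanishingIdeal_iff] at hδQ
    push Not at hδQ
    obtain ⟨y, hy, hyδ⟩ := hδQ
    rw [hO]
    refine ⟨y, by simpa [aeval_eq_eval] using hyδ, ?_⟩
    funext i
    have hmem : X i - C (x i) ∈ (PrimeSpectrum.comap f Q).asIdeal := by
      rw [hQ]
      refine (mem_vanishingIdeal_singleton_iff x _).2 ?_
      simp
    have hfX : f (X i - C (x i)) = φ i - C (x i) := by
      simp [f, algebraMap_eq]
    have := hy (f (X i - C (x i))) hmem
    rw [hfX, map_sub, aeval_C] at this
    exact (sub_eq_zero.1 (by simpa [aeval_eq_eval] using this)).symm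

/-! ### Plücker coordinates -/

/-- The Plücker coordinates of `f_1 ∧ ⋯ ∧ f_k`, multiplied by the coefficients of `h`: the cone over
the Segre–Plücker embedding of `ℛ`. -/
noncomputable def pluckerPoint (f : Fin k → Form K n) (h : Form K n) :
    (Fin k → Mon n d) × Mon n 1 → K := fun a =>
  (Matrix.of fun i j : Fin k => coeff (a.1 j : Fin (n + 1) →₀ ℕ) (f i)).det *
    coeff (a.2 : Fin (n + 1) →₀ ℕ) h

theorem pluckerPoint_sum_smul (f : Fin k → Form K n) (h : Form K n) (M : Matrix (Fin k) (Fin k) K)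
    (c : K) : pluckerPoint (d := d) (fun i => ∑ j, M i j • f j) (c • h)
      = (M.det * c) • pluckerPoint f h := by
  funext a
  have hmul : (Matrix.of fun i j : Fin k =>
      coeff (a.1 j : Fin (n + 1) →₀ ℕ) (∑ j, M i j • f j))
      = M * Matrix.of fun i j : Fin k => coeff (a.1 j : Fin (n + 1) →₀ ℕ) (f i) := by
    ext i j
    simp [Matrix.mul_apply, coeff_sum]
  simp only [pluckerPoint, hmul, Matrix.det_mul, coeff_smul, smul_eq_mul, Pi.smul_apply]
  ring

/-- A linear system is determined by its Plücker coordinates up to a factor: by Cramer's rule, the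
coefficients of the basis normalised at a nonzero minor are ratios of minors. -/
theorem Gr.eq_of_minors_eq {Φ Ψ : Gr K n d k} (hk : k ≠ 0) {f g : Fin k → Form K n}
    (hf : Φ.IsFrame f) (hg : Ψ.IsFrame g) {e : K}
    (h : ∀ I : Fin k → Mon n d,
      (Matrix.of fun i j : Fin k => coeff (I j : Fin (n + 1) →₀ ℕ) (f i)).det
        = e * (Matrix.of fun i j : Fin k => coeff (I j : Fin (n + 1) →₀ ℕ) (g i)).det) :
    Φ = Ψ := by
  obtain ⟨I, hI⟩ := hf.exists_minor_ne_zero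
  let N (b : Fin k → Form K n) : Matrix (Fin k) (Fin k) K :=
    Matrix.of fun i j : Fin k => coeff (I j : Fin (n + 1) →₀ ℕ) (b i)
  let v (b : Fin k → Form K n) (J : Mon n d) : Fin k → K := fun i =>
    coeff (J : Fin (n + 1) →₀ ℕ) (b i)
  have hcr (b : Fin k → Form K n) (J : Mon n d) (j : Fin k) : (N b).cramer (v b J) j =
      (Matrix.of fun i j' : Fin k =>
        coeff (Function.update I j J j' : Fin (n + 1) →₀ ℕ) (b i)).det := by
    rw [Matrix.cramer_apply]
    congr 1
    ext i j'
    by_cases hj : j' = j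
    · subst hj; simp [v]
    · simp [N, hj]
  have hcram (J : Mon n d) : (N f).cramer (v f J) = e • (N g).cramer (v g J) := by
    funext j
    rw [Pi.smul_apply, hcr, hcr, smul_eq_mul]
    exact h (Function.update I j J)
  have hN : (N f).det = e * (N g).det := h I
  have hNf : (N f).det ≠ 0 := hI
  -- `f = M g` with `M = (det N f)⁻¹ • e • N f * adj (N g)`.
  let M : Matrix (Fin k) (Fin k) K := ((N f).det⁻¹ * e) • (N f * (N g).adjugate)
  have hM (J : Mon n d) : v f J = M.mulVec (v g J) := by
    have h1 : (N f).mulVec ((N f).cramer (v f J)) = (N f).det • v f J := Matrix.mulVec_cramer _ _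
    rw [hcram, Matrix.mulVec_smul, Matrix.cramer_eq_adjugate_mulVec, Matrix.mulVec_mulVec] at h1
    simp only [M, Matrix.smul_mulVec, mul_smul]
    rw [h1, smul_smul, inv_mul_cancel₀ hNf, one_smul]
  have hfg (i : Fin k) : f i = ∑ j, M i j • g j := by
    apply eq_of_coeff_mon_eq (hf.isHomogeneous i)
    · exact IsHomogeneous.sum _ _ _ fun j _ => by
        rw [smul_eq_C_mul]; exact (hg.isHomogeneous j).C_mul _
    · intro J
      have := congrFun (hM J) i
      simpa [v, Matrix.mulVec, dotProduct, coeff_sum] using this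
  have hfΨ : Ψ.IsFrame f := by
    apply Gr.isFrame_of_linearIndependent hk hf.linearIndependent
    intro i
    rw [hfg]
    exact Submodule.sum_mem _ fun j _ => Ψ.space.smul_mem _ (hg.mem j)
  exact Gr.ext_space (hf.symm.trans hfΨ)

theorem Pair.eq_of_pluckerPoint_eq (hk : k ≠ 0) {p q : Pair K n d k} {f f' : Fin k → Form K n}
    {h h' : Form K n} (hf : p.S.IsFrame f) (hh : Submodule.span K {h} = p.H.space)
    (hf' : q.S.IsFrame f') (hh' : Submodule.span K {h'} = q.H.space)
    (heq : pluckerPoint (d := d) f h = pluckerPoint f' h') : p = q := by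
  have hhh : h.IsHomogeneous 1 := Gr.isHomogeneous (hh ▸ Submodule.mem_span_singleton_self h)
  have hhh' : h'.IsHomogeneous 1 := Gr.isHomogeneous (hh' ▸ Submodule.mem_span_singleton_self h')
  have heq' (I : Fin k → Mon n d) (J : Mon n 1) := congrFun heq (I, J)
  simp only [pluckerPoint] at heq'
  obtain ⟨I, hI⟩ := hf.exists_minor_ne_zero
  obtain ⟨J, hJ⟩ : ∃ J : Mon n 1, coeff (J : Fin (n + 1) →₀ ℕ) h ≠ 0 := by
    by_contra! hJ
    exact Gr.ne_zero_of_span_eq hh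
      (eq_of_coeff_mon_eq hhh (isHomogeneous_zero _ _ _) (by simpa using hJ))
  have hne := heq' I J ▸ mul_ne_zero hI hJ
  have hI' := left_ne_zero_of_mul hne
  have hJ' := right_ne_zero_of_mul hne
  ext1
  · apply Gr.eq_of_minors_eq (e := coeff (J : Fin (n + 1) →₀ ℕ) h' / coeff (J : Fin (n + 1) →₀ ℕ) h) hk hf
      hf'
    intro I'
    have := heq' I' J
    field_simp
    linear_combination this
  · apply Gr.ext_space
    rw [← hh, ← hh']
    set D := (Matrix.of fun i j : Fin k => coeff (I j : Fin (n + 1) →₀ ℕ) (f i)).det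
    set D' := (Matrix.of fun i j : Fin k => coeff (I j : Fin (n + 1) →₀ ℕ) (f' i)).det
    have hc : D' / D ≠ 0 := div_ne_zero hI' hI
    have : h = (D' / D) • h' := by
      apply eq_of_coeff_mon_eq hhh
      · rw [smul_eq_C_mul]; exact hhh'.C_mul _
      · intro J'
        have := heq' I J'
        rw [coeff_smul, smul_eq_mul]
        field_simp
        linear_combination this
    rw [this, Submodule.span_singleton_smul_eq (isUnit_iff_ne_zero.2 hc)]

/-! ### Cones over orbits -/

/-- The cone over the orbit of `p` in the Segre–Plücker embedding. -/
def Pair.orbitCone (p : Pair K n d k) : Set ((Fin k → Mon n d) × Mon n 1 → K) :=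
  {z | ∃ (A : SL K n) (f : Fin k → Form K n) (h : Form K n), (p.act A).S.IsFrame f ∧
    Submodule.span K {h} = (p.act A).H.space ∧ z = pluckerPoint f h}

theorem Pair.smul_mem_orbitCone {p : Pair K n d k} {z} (hz : z ∈ p.orbitCone) {c : K} (hc : c ≠ 0) :
    c • z ∈ p.orbitCone := by
  obtain ⟨A, f, h, hf, hh, rfl⟩ := hz
  refine ⟨A, f, c • h, hf, ?_, ?_⟩
  · rw [Submodule.span_singleton_smul_eq (isUnit_iff_ne_zero.2 hc), hh]
  · funext a
    simp only [pluckerPoint, Pi.smul_apply, smul_eq_mul, coeff_smul]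
    ring

theorem eval_smul_of_isHomogeneous {σ : Type*} {F : MvPolynomial σ K} {m : ℕ}
    (hF : F.IsHomogeneous m) (c : K) (z : σ → K) : eval (c • z) F = c ^ m * eval z F := by
  rw [eval_eq, eval_eq, Finset.mul_sum]
  apply Finset.sum_congr rfl
  intro I hI
  have hdeg : ∑ i ∈ I.support, I i = m := hF.degree_eq_sum_deg_support hI |>.symm
  simp only [Pi.smul_apply, smul_eq_mul, mul_pow, Finset.prod_mul_distrib, Finset.prod_pow_eq_pow_sum,
    hdeg]
  ring

/-- The ideal of a cone is homogeneous. -/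
theorem eval_homogeneousComponent_eq_zero [Infinite K] {σ : Type*} {O : Set (σ → K)}
    (hO : ∀ z ∈ O, ∀ c : K, c ≠ 0 → c • z ∈ O) {F : MvPolynomial σ K}
    (hF : F ∈ vanishingIdeal K O) (m : ℕ) {z : σ → K} (hz : z ∈ O) :
    eval z (homogeneousComponent m F) = 0 := by
  let Q : Polynomial K := ∑ i ∈ Finset.range (F.totalDegree + 1),
    Polynomial.monomial i (eval z (homogeneousComponent i F))
  have hQ : Q = 0 := by
    apply Polynomial.eq_of_infinite_eval_eq
    apply Set.Infinite.mono (s := {0}ᶜ) _ (Set.finite_singleton (0 : K)).infinite_compl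
    intro c hc
    have h1 := hF _ (hO z hz c hc)
    rw [aeval_eq_eval] at h1
    have h1 : eval (c • z) F = 0 := h1
    rw [← sum_homogeneousComponent F, map_sum] at h1
    simp only [eval_smul_of_isHomogeneous (homogeneousComponent_isHomogeneous _ F)] at h1
    simp only [Set.mem_ofPred_eq, Q, Polynomial.eval_finsetSum, Polynomial.eval_monomial,
      Polynomial.eval_zero]
    rw [← h1]
    exact Finset.sum_congr rfl fun i _ => mul_comm _ _
  by_cases hm : m ≤ F.totalDegree
  · have := congrArg (fun q => Polynomial.coeff q m) hQ
    simpa [Q, Polynomial.coeff_monomial, Nat.lt_succ_iff.2 hm] using this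
  · rw [homogeneousComponent_eq_zero _ _ (not_le.1 hm), map_zero]

/-- Forms of degree `m` in the Segre–Plücker coordinates are sections of `𝒪(m, m)`. -/
theorem exists_section_of_isHomogeneous {m : ℕ}
    {F : MvPolynomial ((Fin k → Mon n d) × Mon n 1) K} (hF : F.IsHomogeneous m) :
    ∃ G : MvPolynomial (CoeffIndex n d k) K, IsSection m m G ∧
      ∀ (f : Fin k → Form K n) (h : Form K n),
        eval (coeffs f h) G = eval (pluckerPoint f h) F := by
  let φ : (Fin k → Mon n d) × Mon n 1 → MvPolynomial (CoeffIndex n d k) K := fun a =>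
    (Matrix.of fun i j : Fin k => (X (Sum.inl (i, a.1 j)) : MvPolynomial (CoeffIndex n d k) K)).det *
      X (Sum.inr a.2)
  have hφ (f : Fin k → Form K n) (h : Form K n) (a) :
      eval (coeffs f h) (φ a) = pluckerPoint f h a := by
    simp only [φ, map_mul, RingHom.map_det, eval_X, pluckerPoint]
    congr 2
    ext i j
    simp [coeffs]
  have heval (f : Fin k → Form K n) (h : Form K n) :
      eval (coeffs f h) (aeval φ F) = eval (pluckerPoint f h) F := by
    have : (aeval (R := K) (coeffs (d := d) f h)).comp (aeval φ) = aeval (R := K) (pluckerPoint f h) := by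
      ext1 a
      simpa [aeval_eq_eval] using hφ f h a
    simpa [aeval_eq_eval] using DFunLike.congr_fun this F
  refine ⟨aeval φ F, ?_, heval⟩
  intro f h M c _ _
  rw [heval, heval, pluckerPoint_sum_smul, eval_smul_of_isHomogeneous hF, mul_pow]

theorem exists_eval_eq_coeff_subst (f : Form K n) (I : Fin (n + 1) →₀ ℕ) :
    ∃ P : MvPolynomial (Fin (n + 1) × Fin (n + 1)) K,
      ∀ y : Fin (n + 1) × Fin (n + 1) → K,
        eval y P = coeff I (subst (Matrix.of fun i j => y (i, j)) f) := by
  let G : MvPolynomial (Fin (n + 1)) (MvPolynomial (Fin (n + 1) × Fin (n + 1)) K) :=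
    aeval (fun i => ∑ j, C (X (i, j)) * X j) f
  refine ⟨coeff I G, fun y => ?_⟩
  rw [← coeff_map]
  congr 1
  have : ((mapAlgHom (aeval y)).comp (aeval fun i => ∑ j, C (X (i, j)) * X j) :
      Form K n →ₐ[K] Form K n) = subst (Matrix.of fun i j => y (i, j)) := by
    ext1 i
    simp [subst]
  exact DFunLike.congr_fun this f

theorem subst_smul {c : K} (A : Matrix (Fin (n + 1)) (Fin (n + 1)) K) {f : Form K n} {m : ℕ}
    (hf : f.IsHomogeneous m) : subst (c • A) f = c ^ m • subst A f := by
  have h : c • A = Matrix.diagonal (fun _ => c) * A := by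
    rw [← Matrix.smul_eq_diagonal_mul]
  rw [h, ← subst_subst, ← map_smul]
  congr 1
  ext I
  rw [coeff_subst_diagonal, coeff_smul, Finset.prod_pow_eq_pow_sum, smul_eq_mul]
  by_cases h0 : coeff I f = 0
  · rw [h0, mul_zero, mul_zero]
  · rw [← degree_eq_of_coeff_ne_zero hf h0, Finsupp.degree_eq_sum]

/-- The cone over an orbit is parametrised by the invertible matrices: over an algebraically closed
field all scalings come from scalar matrices. -/
theorem Pair.exists_orbitCone_eq [IsAlgClosed K] (hk : k ≠ 0) (p : Pair K n d k) :
    ∃ (φ : (Fin k → Mon n d) × Mon n 1 → MvPolynomial (Fin (n + 1) × Fin (n + 1)) K)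
      (δ : MvPolynomial (Fin (n + 1) × Fin (n + 1)) K), δ ≠ 0 ∧
      p.orbitCone = {z | ∃ y, eval y δ ≠ 0 ∧ z = fun i => eval y (φ i)} := by
  obtain ⟨f, hf⟩ := p.S.exists_isFrame hk
  obtain ⟨h, hh⟩ := p.H.exists_span_eq
  have hfh := hf.isHomogeneous
  have hhh : h.IsHomogeneous 1 := Gr.isHomogeneous (hh ▸ Submodule.mem_span_singleton_self h)
  choose P hP using fun (g : Form K n) I => exists_eval_eq_coeff_subst g I
  let φ : (Fin k → Mon n d) × Mon n 1 → MvPolynomial (Fin (n + 1) × Fin (n + 1)) K := fun a =>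
    (Matrix.of fun i j : Fin k => P (f i) (a.1 j)).det * P h a.2
  let δ : MvPolynomial (Fin (n + 1) × Fin (n + 1)) K := (Matrix.of fun i j => X (i, j)).det
  have hδ (y : Fin (n + 1) × Fin (n + 1) → K) :
      eval y δ = (Matrix.of fun i j => y (i, j)).det := by
    simp only [δ, RingHom.map_det]
    congr 1
    ext i j
    simp
  have hφ (y : Fin (n + 1) × Fin (n + 1) → K) : (fun a => eval y (φ a)) =
      pluckerPoint (fun i => subst (Matrix.of fun i j => y (i, j)) (f i))
        (subst (Matrix.of fun i j => y (i, j)) h) := by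
    funext a
    simp only [φ, map_mul, RingHom.map_det, pluckerPoint, hP]
    congr 2
    ext i j
    simp [hP]
  have hscale (s : K) (A : Matrix (Fin (n + 1)) (Fin (n + 1)) K) :
      pluckerPoint (d := d) (fun i => subst (s • A) (f i)) (subst (s • A) h)
        = s ^ (d * k + 1) • pluckerPoint (fun i => subst A (f i)) (subst A h) := by
    have := pluckerPoint_sum_smul (d := d) (fun i => subst A (f i)) (subst A h)
      (Matrix.diagonal fun _ => s ^ d) s
    simp only [Matrix.diagonal_apply, ite_smul, zero_smul, Finset.sum_ite_eq, Finset.mem_univ,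
      if_true, Matrix.det_diagonal, Finset.prod_const, Finset.card_univ, Fintype.card_fin] at this
    rw [pow_succ, pow_mul, ← this, subst_smul A hhh, pow_one]
    congr 1
    funext i
    exact subst_smul A (hfh i)
  refine ⟨φ, δ, ?_, ?_⟩
  · intro h0
    have := hδ fun ij => (1 : Matrix (Fin (n + 1)) (Fin (n + 1)) K) ij.1 ij.2
    rw [h0, map_zero] at this
    have h1 : (Matrix.of fun i j => (1 : Matrix (Fin (n + 1)) (Fin (n + 1)) K) i j) = 1 := rfl
    simp only [h1, Matrix.det_one] at this
    exact zero_ne_one this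
  · ext z
    constructor
    · rintro ⟨A, f', h', hf', hh', rfl⟩
      obtain ⟨M, hM, rfl⟩ := (hf.act A).exists_matrix (Φ := p.S.act A) hf'
      obtain ⟨c, rfl⟩ : ∃ c : K, c • subst A.1 h = h' := by
        apply Submodule.mem_span_singleton.1
        rw [Gr.span_act hh A]
        exact hh' ▸ Submodule.mem_span_singleton_self h'
      have hc : c ≠ 0 := by
        rintro rfl
        exact Gr.ne_zero_of_span_eq hh' (zero_smul _ _)
      obtain ⟨s, hs⟩ := IsAlgClosed.exists_pow_nat_eq (M.det * c) (Nat.succ_pos (d * k))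
      have hs0 : s ≠ 0 := by
        rintro rfl
        rw [zero_pow (Nat.succ_ne_zero _)] at hs
        exact mul_ne_zero hM hc hs.symm
      refine ⟨fun ij => (s • A.1) ij.1 ij.2, ?_, ?_⟩
      · rw [hδ]
        change (s • A.1).det ≠ 0
        rw [Matrix.det_smul, A.2, mul_one]
        exact pow_ne_zero _ hs0
      · rw [hφ, pluckerPoint_sum_smul, ← hs]
        exact (hscale s A.1).symm
    · rintro ⟨y, hy, rfl⟩
      rw [hδ] at hy
      rw [hφ]
      set B : Matrix (Fin (n + 1)) (Fin (n + 1)) K := Matrix.of fun i j => y (i, j)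
      obtain ⟨s, hs⟩ := IsAlgClosed.exists_pow_nat_eq B.det (Nat.succ_pos n)
      have hs0 : s ≠ 0 := by
        rintro rfl
        rw [zero_pow (Nat.succ_ne_zero _)] at hs
        exact hy hs.symm
      let A : SL K n := ⟨s⁻¹ • B, by
        rw [Matrix.det_smul, Fintype.card_fin, ← hs, inv_pow, inv_mul_cancel₀ (pow_ne_zero _ hs0)]⟩
      have hBA : B = s • A.1 := by simp [A, hs0]
      rw [hBA, hscale]
      exact Pair.smul_mem_orbitCone ⟨A, _, _, hf.act A, Gr.span_act hh A, rfl⟩ (pow_ne_zero _ hs0)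

/-! ### Closed orbits -/

/-- The part of degree `d` of a polynomial. -/
noncomputable def truncate (d : ℕ) (f : Form K n) : Form K n :=
  ∑ I : Mon n d, monomial (I : Fin (n + 1) →₀ ℕ) (coeff (I : Fin (n + 1) →₀ ℕ) f)

theorem truncate_isHomogeneous (f : Form K n) : (truncate d f).IsHomogeneous d :=
  IsHomogeneous.sum _ _ _ fun I _ => isHomogeneous_monomial _ (mem_mon_iff.1 I.2)

theorem coeff_truncate (f : Form K n) (I : Mon n d) :
    coeff (I : Fin (n + 1) →₀ ℕ) (truncate d f) = coeff (I : Fin (n + 1) →₀ ℕ) f := by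
  rw [truncate, coeff_sum, Finset.sum_eq_single I]
  · simp
  · intro J _ hJ
    rw [coeff_monomial, if_neg fun h => hJ (Subtype.ext h)]
  · simp

theorem truncate_eq_self {f : Form K n} (hf : f.IsHomogeneous d) : truncate d f = f :=
  eq_of_coeff_mon_eq (truncate_isHomogeneous f) hf (coeff_truncate f)

theorem truncate_sum_smul {ι : Type*} (s : Finset ι) (c : ι → K) (f : ι → Form K n) :
    truncate d (∑ i ∈ s, c i • f i) = ∑ i ∈ s, c i • truncate d (f i) := by
  simp only [truncate, coeff_sum, coeff_smul, map_sum, Finset.smul_sum, smul_monomial]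
  rw [Finset.sum_comm]

theorem truncate_smul (c : K) (f : Form K n) : truncate d (c • f) = c • truncate d f := by
  simpa using truncate_sum_smul (d := d) {()} (fun _ => c) fun _ => f

/-- The group acts on sections. -/
theorem IsSection.exists_subst {m l : ℕ} {F : MvPolynomial (CoeffIndex n d k) K}
    (hF : IsSection m l F) (A : Matrix (Fin (n + 1)) (Fin (n + 1)) K) :
    ∃ G : MvPolynomial (CoeffIndex n d k) K, IsSection m l G ∧
      ∀ (f : Fin k → Form K n) (h : Form K n), (∀ i, (f i).IsHomogeneous d) → h.IsHomogeneous 1 →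
        eval (coeffs f h) G = eval (coeffs (fun i => subst A (f i)) (subst A h)) F := by
  let φ : CoeffIndex n d k → MvPolynomial (CoeffIndex n d k) K :=
    Sum.elim
      (fun a => ∑ J : Mon n d, C (coeff (a.2 : Fin (n + 1) →₀ ℕ)
        (subst A (monomial (J : Fin (n + 1) →₀ ℕ) 1))) * X (Sum.inl (a.1, J)))
      (fun I => ∑ J : Mon n 1, C (coeff (I : Fin (n + 1) →₀ ℕ)
        (subst A (monomial (J : Fin (n + 1) →₀ ℕ) 1))) * X (Sum.inr J))
  have hsub {e : ℕ} (g : Form K n) (I : Fin (n + 1) →₀ ℕ) :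
      coeff I (subst A (truncate e g)) = ∑ J : Mon n e, coeff I
        (subst A (monomial (J : Fin (n + 1) →₀ ℕ) 1)) * coeff (J : Fin (n + 1) →₀ ℕ) g := by
    have (J : Mon n e) : monomial (J : Fin (n + 1) →₀ ℕ) (coeff (J : Fin (n + 1) →₀ ℕ) g) =
        coeff (J : Fin (n + 1) →₀ ℕ) g • (monomial (J : Fin (n + 1) →₀ ℕ) 1 : Form K n) := by
      rw [smul_monomial, smul_eq_mul, mul_one]
    simp only [truncate, this, map_sum, map_smul, coeff_sum, coeff_smul, smul_eq_mul, mul_comm]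
  have hφ (f : Fin k → Form K n) (h : Form K n) (a) : eval (coeffs f h) (φ a) =
      coeffs (fun i => subst A (truncate d (f i))) (subst A (truncate 1 h)) a := by
    rcases a with ⟨i, I⟩ | I
    · simp [φ, coeffs, hsub]
    · simp [φ, coeffs, hsub]
  have heval (f : Fin k → Form K n) (h : Form K n) : eval (coeffs f h) (aeval φ F) =
      eval (coeffs (fun i => subst A (truncate d (f i))) (subst A (truncate 1 h))) F := by
    have : (aeval (R := K) (coeffs (d := d) f h)).comp (aeval φ) = aeval (R := K)
        (coeffs (fun i => subst A (truncate d (f i))) (subst A (truncate 1 h))) := by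
      ext1 a
      simpa [aeval_eq_eval] using hφ f h a
    simpa [aeval_eq_eval] using DFunLike.congr_fun this F
  refine ⟨aeval φ F, ?_, ?_⟩
  · intro f h M c hM hc
    rw [heval, heval, ← hF _ _ M c hM hc]
    simp only [truncate_sum_smul, truncate_smul, map_sum, map_smul]
  · intro f h hf hh
    rw [heval, truncate_eq_self hh]
    simp only [truncate_eq_self (hf _)]

theorem IsInvariantSection.mul {t : ℚ} {m m' : ℕ} {F G : MvPolynomial (CoeffIndex n d k) K}
    (hF : IsInvariantSection t m F) (hG : IsInvariantSection t m' G) :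
    IsInvariantSection t (m + m') (F * G) := by
  obtain ⟨hF, l, hl, hFs⟩ := hF
  obtain ⟨hG, l', hl', hGs⟩ := hG
  refine ⟨fun A f h hf hh => ?_, l + l', ?_, fun f h M c hM hc => ?_⟩
  · rw [map_mul, map_mul, hF A f h hf hh, hG A f h hf hh]
  · push_cast
    rw [hl, hl']
    ring
  · rw [map_mul, map_mul, hFs f h M c hM hc, hGs f h M c hM hc]
    ring

theorem IsInvariantSection.pow {t : ℚ} {m : ℕ} {F : MvPolynomial (CoeffIndex n d k) K}
    (hF : IsInvariantSection t m F) (j : ℕ) : IsInvariantSection t (m * j) (F ^ j) := by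
  obtain ⟨hF, l, hl, hFs⟩ := hF
  refine ⟨fun A f h hf hh => ?_, l * j, ?_, fun f h M c hM hc => ?_⟩
  · rw [map_pow, map_pow, hF A f h hf hh]
  · push_cast
    rw [hl]
    ring
  · rw [map_pow, map_pow, hFs f h M c hM hc]
    ring

theorem IsInvariantSection.sub_C_mul {t : ℚ} {m : ℕ} {F G : MvPolynomial (CoeffIndex n d k) K}
    (hF : IsInvariantSection t m F) (hG : IsInvariantSection t m G) (a : K) :
    IsInvariantSection t m (F - C a * G) := by
  obtain ⟨hF, l, hl, hFs⟩ := hF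
  obtain ⟨hG, l', hl', hGs⟩ := hG
  obtain rfl : l = l' := by
    have : (l : ℚ) = l' := hl.trans hl'.symm
    exact_mod_cast this
  refine ⟨fun A f h hf hh => ?_, l, hl, fun f h M c hM hc => ?_⟩
  · simp only [map_sub, map_mul, eval_C, hF A f h hf hh, hG A f h hf hh]
  · simp only [map_sub, map_mul, eval_C, hFs f h M c hM hc, hGs f h M c hM hc]
    ring

/-- The points of `Proj` that come from the semistable locus are closed: their ideals are maximal, so
that an inclusion of ideals is an equality. -/
theorem vanishes_of_forall_vanishes_imp {t : ℚ} (hk : k ≠ 0) {p q : Pair K n d k}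
    (hq : q ∈ semistableLocus K n d k t)
    (h : ∀ (m : ℕ) (F : MvPolynomial (CoeffIndex n d k) K), IsInvariantSection t m F →
      p.Vanishes F → q.Vanishes F)
    {j : ℕ} {F : MvPolynomial (CoeffIndex n d k) K} (hF : IsInvariantSection t j F)
    (hqF : q.Vanishes F) : p.Vanishes F := by
  by_contra hpF
  obtain ⟨m, G, hm, hG, hqG⟩ := hq
  have hpG : ¬ p.Vanishes G := fun h' => hqG (h m G hG h')
  obtain ⟨f, hf⟩ := p.S.exists_isFrame hk
  obtain ⟨l, hl⟩ := p.H.exists_span_eq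
  obtain ⟨f', hf'⟩ := q.S.exists_isFrame hk
  obtain ⟨l', hl'⟩ := q.H.exists_span_eq
  obtain ⟨-, a, -, hFs⟩ := id hF
  obtain ⟨-, b, -, hGs⟩ := id hG
  rw [hFs.vanishes_iff hf hl] at hpF
  rw [hGs.vanishes_iff hf hl] at hpG
  rw [hFs.vanishes_iff hf' hl'] at hqF
  rw [hGs.vanishes_iff hf' hl'] at hqG
  -- `F ^ m * G` and `G ^ (j + 1)` have the same degree, so they are proportional at `p`.
  let c := eval (coeffs f l) (F ^ m * G) / eval (coeffs f l) (G ^ (j + 1))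
  have hc : c ≠ 0 := by
    simp only [c, map_mul, map_pow]
    exact div_ne_zero (mul_ne_zero (pow_ne_zero _ hpF) hpG) (pow_ne_zero _ hpG)
  have hE : IsInvariantSection t (j * m + m) (F ^ m * G - C c * G ^ (j + 1)) := by
    refine ((hF.pow m).mul hG).sub_C_mul ?_ c
    have := hG.pow (j + 1)
    rwa [show m * (j + 1) = j * m + m by ring] at this
  obtain ⟨-, e, -, hEs⟩ := id hE
  have hpE : p.Vanishes (F ^ m * G - C c * G ^ (j + 1)) := by
    rw [hEs.vanishes_iff hf hl, map_sub, map_mul (eval _) (C c), eval_C]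
    have : eval (coeffs f l) (G ^ (j + 1)) ≠ 0 := by
      rw [map_pow]
      exact pow_ne_zero _ hpG
    simp only [c]
    rw [div_mul_cancel₀ _ this, sub_self]
  have hqE := h _ _ hE hpE f' l' hf' hl'
  rw [map_sub, map_mul, map_mul, map_pow, map_pow, eval_C, hqF, zero_pow hm.ne', zero_mul, zero_sub,
    neg_eq_zero] at hqE
  exact mul_ne_zero hc (pow_ne_zero _ hqG) hqE

theorem act_mem_semistableLocus {t : ℚ} (hk : k ≠ 0) {p : Pair K n d k}
    (hp : p ∈ semistableLocus K n d k t) (A : SL K n) : p.act A ∈ semistableLocus K n d k t := by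
  obtain ⟨m, F, hm, hF, hpF⟩ := hp
  obtain ⟨hinv, l, -, hs⟩ := id hF
  exact ⟨m, F, hm, hF, fun h => hpF ((hinv.vanishes_act_iff hs hk p A).1 h)⟩

/-- Every fibre of the quotient map contains an orbit closed in the semistable locus: one whose cone
has maximal ideal.  An orbit in its closure has the same ideal, and both contain a nonempty open
subset of their common closure by Chevalley's theorem, so they meet. -/
theorem exists_hasClosedOrbit [IsAlgClosed K] (hk : k ≠ 0) {t : ℚ}
    (x : GITQuotient K n d k t) :
    ∃ p : semistableLocus K n d k t, toQuotient p = x ∧ p.1.HasClosedOrbit t := by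
  obtain ⟨p, rfl⟩ : ∃ p, toQuotient p = x := Quotient.exists_rep x
  let J (q : semistableLocus K n d k t) := vanishingIdeal K q.1.orbitCone
  obtain ⟨q, hq, hmax⟩ : ∃ q, toQuotient q = toQuotient p ∧
      ∀ r, toQuotient r = toQuotient p → ¬ J q < J r := by
    obtain ⟨I, ⟨q, hq, rfl⟩, hI⟩ := set_has_maximal_iff_noetherian.2
      (inferInstanceAs (IsNoetherianRing (MvPolynomial ((Fin k → Mon n d) × Mon n 1) K)))
      (J '' {q | toQuotient q = toQuotient p}) ⟨_, p, rfl, rfl⟩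
    exact ⟨q, hq, fun r hr => hI _ ⟨r, hr, rfl⟩⟩
  refine ⟨q, hq, ?_⟩
  let T : Set (MvPolynomial (CoeffIndex n d k) K) :=
    {F | (∃ m l, IsSection m l F) ∧ ∀ A : SL K n, (q.1.act A).Vanishes F}
  refine ⟨{r | ∀ F ∈ T, r.Vanishes F}, ⟨T, fun F hF => hF.1, rfl⟩, ?_⟩
  ext r
  constructor
  · rintro ⟨A, rfl⟩
    exact ⟨fun F hF => hF.2 A, act_mem_semistableLocus hk q.2 A⟩
  rintro ⟨hrT, hr⟩
  have hrq : toQuotient ⟨r, hr⟩ = toQuotient q := by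
    have himp (m : ℕ) (F : MvPolynomial (CoeffIndex n d k) K) (hF : IsInvariantSection t m F)
        (hqF : q.1.Vanishes F) : r.Vanishes F := by
      obtain ⟨hinv, l, -, hs⟩ := id hF
      exact hrT F ⟨⟨m, l, hs⟩, fun A => (hinv.vanishes_act_iff hs hk q.1 A).2 hqF⟩
    exact Quotient.sound fun m F hF =>
      ⟨fun h => vanishes_of_forall_vanishes_imp hk hr himp hF h, himp m F hF⟩
  -- The closure of the orbit is invariant.
  have hact (A : SL K n) (F : MvPolynomial (CoeffIndex n d k) K) (hF : F ∈ T) :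
      (r.act A).Vanishes F := by
    obtain ⟨⟨m, l, hs⟩, hFq⟩ := hF
    obtain ⟨G, hGs, hG⟩ := hs.exists_subst A.1
    have key (s : Pair K n d k) : s.Vanishes G ↔ (s.act A).Vanishes F := by
      obtain ⟨f, hf⟩ := s.S.exists_isFrame hk
      obtain ⟨h, hh⟩ := s.H.exists_span_eq
      rw [hGs.vanishes_iff hf hh, hs.vanishes_iff (p := s.act A) (hf.act A) (Gr.span_act hh A),
        hG f h hf.isHomogeneous (Gr.isHomogeneous (hh ▸ Submodule.mem_span_singleton_self h))]
    refine (key r).1 (hrT G ⟨⟨m, l, hGs⟩, fun B => (key _).2 ?_⟩)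
    rw [Pair.act_mul]
    exact hFq _
  have hle : J q ≤ J ⟨r, hr⟩ := by
    rintro F hF z ⟨A, f, h, hf, hh, rfl⟩
    rw [aeval_eq_eval, ← sum_homogeneousComponent F]
    rw [map_sum]
    refine Finset.sum_eq_zero fun m _ => ?_
    obtain ⟨G, hGs, hG⟩ := exists_section_of_isHomogeneous (homogeneousComponent_isHomogeneous m F)
    rw [← hG]
    refine hact A G ⟨⟨m, m, hGs⟩, fun B f' h' hf' hh' => ?_⟩ f h hf hh
    rw [hG]
    exact eval_homogeneousComponent_eq_zero (fun z hz c hc => Pair.smul_mem_orbitCone hz hc) hF m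
      ⟨B, f', h', hf', hh', rfl⟩
  have hJ : J q = J ⟨r, hr⟩ := by
    by_contra hne
    exact hmax _ (hrq.trans hq) (lt_of_le_of_ne hle hne)
  obtain ⟨φ, δ, hδ, hO⟩ := q.1.exists_orbitCone_eq hk
  obtain ⟨g, hg, hgO⟩ := exists_eval_ne_zero_imp_mem_image φ hδ hO
  have hgr : g ∉ J ⟨r, hr⟩ := hJ ▸ hg
  obtain ⟨z, hzr, hz⟩ : ∃ z ∈ r.orbitCone, aeval z g ≠ 0 := by
    by_contra! h
    exact hgr h
  have hzq : z ∈ q.1.orbitCone := by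
    refine hgO z ?_ (by simpa [aeval_eq_eval] using hz)
    change z ∈ zeroLocus K (J q)
    rw [hJ]
    exact zeroLocus_vanishingIdeal_le _ hzr
  obtain ⟨A, f, h, hf, hh, rfl⟩ := hzr
  obtain ⟨B, f', h', hf', hh', heq⟩ := hzq
  have := Pair.eq_of_pluckerPoint_eq hk hf hh hf' hh' heq
  refine ⟨B * A⁻¹, ?_⟩
  rw [← Pair.act_mul, ← this, Pair.act_mul, mul_inv_cancel, Pair.act_one]

end VGIT

theorem theorem1p3 {K : Type*} [Field K] [IsAlgClosed K] (n d k : ℕ) (hk : 1 ≤ k) (hd : 1 < d)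
    (hkd : k * d ≤ n + 1) :
    -- Fano or Calabi–Yau: points of the quotient
    (∀ t : ℚ, 0 < t → ∀ x : VGIT.GITQuotient K n d k t,
      (∃ p : VGIT.semistableLocus K n d k t,
        VGIT.toQuotient p = x ∧ p.1.HasClosedOrbit t) ∧
      (∀ p : VGIT.semistableLocus K n d k t, VGIT.toQuotient p = x →
        p.1.S.NoMemberContains p.1.H ∧
        (p.1.S.IsCompleteIntersection → (p.1.S.IsVariety ∨ k = 1 ∨ (k = 2 ∧ d = 2)) →
          p.1.IsDivisorCompleteIntersection))) ∧
    -- Fano: semistable pairs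
    (k * d ≤ n → ∀ t : ℚ, 0 ≤ t → t ≤ (k * d : ℚ) / n →
      ∀ p : VGIT.Pair K n d k, p.IsSemistable t →
        p.S.NoMemberContains p.H ∧
        (t < 1 → ∀ L : VGIT.Gr K n 1 1, p.S.NoMemberContains L) ∧
        (2 ≤ k → ∀ L : VGIT.Gr K n 1 1, ¬ p.S.ideal ≤ L.ideal) ∧
        (p.S.IsCompleteIntersection → (p.S.IsVariety ∨ k = 1 ∨ (k = 2 ∧ d = 2)) →
          p.IsDivisorCompleteIntersection)) := by
  have hk0 : k ≠ 0 := by omega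
  have hn : 1 ≤ n := by nlinarith
  have hnQ : (1 : ℚ) ≤ n := by exact_mod_cast hn
  have hkdQ : (k * d : ℚ) ≤ n + 1 := by exact_mod_cast hkd
  refine ⟨fun t ht x => ⟨VGIT.exists_hasClosedOrbit hk0 x, fun p _ => ?_⟩,
    fun hkn t ht htk p hp => ?_⟩
  · have hb := VGIT.hasNonnegBounds_of_mem_semistableLocus hk0 p.2
    have hH := hb.noMemberContains hk0 hn (by nlinarith)
    exact ⟨hH, hb.isDivisorCompleteIntersection hk hd ht.le hkd (Or.inl ht) hH⟩
  · have hb := hp.hasNonnegBounds ht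
    have hknQ : (k * d : ℚ) ≤ n := by exact_mod_cast hkn
    have hH := hb.noMemberContains hk0 hn (by nlinarith)
    refine ⟨hH, fun ht1 L => hb.noMemberContains_of_lt hk0 hn (by linarith) L, fun hk2 L => ?_,
      hb.isDivisorCompleteIntersection hk hd ht hkd (Or.inr hkn) hH⟩
    have ht1 : t ≤ 1 := htk.trans (by rw [div_le_one (by linarith)]; exact hknQ)
    have hk2Q : (2 : ℚ) ≤ k := by exact_mod_cast hk2
    exact hb.not_ideal_le hk0 hn (by nlinarith) L
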